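/- Let $k$ be a field and $n\ge 2$. For $\mathbf d\in\mathbb Z^n$ put $\deg(\mathbf d)=d_1+\dots+d_n$. A function on $\mathbb Z^n$ is initially (eventually) zero if it vanishes whenever the degree is sufficiently small (large). A Riemann function with offset $C\in\mathbb Z$ is an initially zero $f:\mathbb Z^n\to\mathbb Z$ with $f(\mathbf d)=\deg(\mathbf d)+C$ for $\deg(\mathbf d)$ sufficiently large; for $\mathbf K\in\mathbb Z^n$ put $f^\wedge_{\mathbf K}(\mathbf d)=f(\mathbf K-\mathbf d)-\deg(\mathbf K-\mathbf d)-C$. The weight of an initially zero $g:\mathbb Z^2\to\mathbb Z$ is the unique initially zero $W$ with $g(\mathbf d)=\sum_{\mathbf a\le\mathbf d}W(\mathbf a)$ for all $\mathbf d$. For distinct $i,j$, let $W_{f;i,j,\mathbf d}$ be the weight of $(a_1,a_2)\mapsto f(\mathbf d+a_1\mathbf e_i+a_2\mathbf e_j)$. A perfect matching is an initially and eventually zero $W:\mathbb Z^2\to\mathbb Z$ which is the indicator function of the graph of a bijection $\mathbb Z\to\mathbb Z$. A $k$-diagram $\mathcal F$ consists of $k$-vector spaces and linear maps $B_1\xrightarrow{\rho_{11}}A_1\xleftarrow{\rho_{31}}B_3\xrightarrow{\rho_{32}}A_2\xleftarrow{\rho_{22}}B_2$;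 $H^0(\mathcal F)$ and $H^1(\mathcal F)$ are the kernel and cokernel of $B_1\oplus B_2\oplus B_3\to A_1\oplus A_2$, $(b_1,b_2,b_3)\mapsto(\rho_{11}b_1-\rho_{31}b_3,\ \rho_{22}b_2-\rho_{32}b_3)$. It is Fredholm if both are finite dimensional. A virtual $k$-diagram is a pair $\mathcal F_1\ominus\mathcal F_2$ of Fredholm $k$-diagrams, and $\mathcal F_1\ominus\mathcal F_2\sim\mathcal F_1'\ominus\mathcal F_2'$ if $\mathcal F_1\oplus\mathcal F_2'\oplus\mathcal G\simeq\mathcal F_1'\oplus\mathcal F_2\oplus\mathcal G$ for some Fredholm $\mathcal G$. On the class of $\mathcal F_1\ominus\mathcal F_2$, $b^i=\dim H^i(\mathcal F_1)-\dim H^i(\mathcal F_2)$ and $\chi=b^0-b^1$. For $\mathbf d\in\mathbb Z^2$ and a perfect matching $W$ with support $S$, $\mathcal M_{W,\mathbf d}$ is the $k$-diagram with $B_i=k^{\oplus\mathbb Z_{\le d_i}}$, $A_i=k^{\oplus\mathbb Z}$ ($i=1,2$), $B_3=k^{\oplus S}$, where $\rho_{11},\rho_{22}$ are the inclusions and $\rho_{31},\rho_{32}$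 are induced by the two projections $S\to\mathbb Z$. For $W:\mathbb Z^2\to\mathbb Z_{\ge0}$, $\mathcal I^{\oplus W}_{\mathbf d}$ is the direct sum over $\mathbf a\in\mathbb Z^2$ of $W(\mathbf a)$ copies of the $k$-diagram with $A_1=A_2=B_3=k$, with $B_j=k$ if $a_j\le d_j$ and $B_j=0$ otherwise ($j=1,2$), and with identities and inclusions as maps. Theorem. Let $f:\mathbb Z^n\to\mathbb Z$ be any Riemann function with offset $C$, and let $\mathbf d,\mathbf K\in\mathbb Z^n$. (1) For all distinct $i,j\in\{1,\dots,n\}$ the weight $W=W_{f;i,j,\mathbf d}$ exists and is unique. It can be written as $W=(W_1+\dots+W_s)-(\tilde W_1+\dots+\tilde W_{s-1})$ with some $s\ge1$ and perfect matchings $W_r,\tilde W_r$ if and only if it is bounded. (2) There is a unique class $[\mathcal M_{f\text{ at }\mathbf d}]$ of virtual $k$-diagrams such that for all distinct $i,j$, with $W=W_{f;i,j,\mathbf d}$, it is the class of $\bigoplus_{r}\mathcal M_{W_r,\mathbf 0}\ominus\bigoplus_{r}\mathcal M_{\tilde W_r,\mathbf 0}$ for every expression of $W$ as in (1), and also the class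 of $\mathcal I^{\oplus W^+}_{\mathbf 0}\ominus\mathcal I^{\oplus W^-}_{\mathbf 0}$, where $W^{\pm}=\max(\pm W,0)$; in particular, all these $k$-diagrams are Fredholm, and the class does not depend on $i,j$ or on the expression. (3) $f^\wedge_{\mathbf K}$ is a Riemann function with offset $-\deg(\mathbf K)-C$, so that (1) and (2) apply to it too, and $$b^0([\mathcal M_{f\text{ at }\mathbf d}])=f(\mathbf d),\qquad \chi([\mathcal M_{f\text{ at }\mathbf d}])=\deg(\mathbf d)+C,$$ $$b^1([\mathcal M_{f\text{ at }\mathbf d}])=f^\wedge_{\mathbf K}(\mathbf K-\mathbf d)=b^0([\mathcal M_{f^\wedge_{\mathbf K}\text{ at }\mathbf K-\mathbf d}]).$$ -/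

import Mathlib

universe u

/-! ### Riemann functions and their weights -/

/-- The degree `d₁ + ⋯ + dₙ` of a vector in `ℤⁿ`. -/
def vecDeg {n : ℕ} (d : Fin n → ℤ) : ℤ := ∑ i, d i

/-- `f(d) = 0` for `deg(d)` sufficiently small. -/
def IsInitiallyZero {n : ℕ} (f : (Fin n → ℤ) → ℤ) : Prop :=
  ∃ a : ℤ, ∀ d, vecDeg d ≤ a → f d = 0

/-- `f(d) = 0` for `deg(d)` sufficiently large. -/
def IsEventuallyZero {n : ℕ} (f : (Fin n → ℤ) → ℤ) : Prop :=
  ∃ b : ℤ, ∀ d, b ≤ vecDeg d → f d = 0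

/-- `f` is a Riemann function with offset `C`. -/
def IsRiemannFunction {n : ℕ} (f : (Fin n → ℤ) → ℤ) (C : ℤ) : Prop :=
  IsInitiallyZero f ∧ ∃ b : ℤ, ∀ d, b ≤ vecDeg d → f d = vecDeg d + C

/-- The `K`-dual `f^∧_K` of a Riemann function `f` with offset `C`. -/
def riemannDual {n : ℕ} (f : (Fin n → ℤ) → ℤ) (C : ℤ) (K : Fin n → ℤ) : (Fin n → ℤ) → ℤ :=
  fun d => f (K - d) - vecDeg (K - d) - C

/-- `W` is the weight of `f`: it is initially zero and `f(d) = ∑_{a ≤ d} W(a)` for all `d`.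
(As `W` is initially zero, only finitely many terms of each sum are nonzero.) -/
def IsWeight {n : ℕ} (f W : (Fin n → ℤ) → ℤ) : Prop :=
  IsInitiallyZero W ∧ ∀ d, f d = ∑ᶠ (a : Fin n → ℤ) (_ : a ≤ d), W a

/-- The two-variable restriction `f_{i,j,d}(a₁, a₂) = f(d + a₁ eᵢ + a₂ eⱼ)`. -/
def twoVarRestriction {n : ℕ} (f : (Fin n → ℤ) → ℤ) (i j : Fin n) (d : Fin n → ℤ) :
    (Fin 2 → ℤ) → ℤ :=
  fun a => f (d + Pi.single i (a 0) + Pi.single j (a 1))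

/-- `W : ℤ² → ℤ` is a perfect matching: it is initially and eventually zero, and it is the
indicator function of the graph of a bijection `ℤ → ℤ`. -/
def IsPerfectMatching (W : (Fin 2 → ℤ) → ℤ) : Prop :=
  IsInitiallyZero W ∧ IsEventuallyZero W ∧
    ∃ π : Equiv.Perm ℤ, ∀ a, W a = if a 1 = π (a 0) then 1 else 0

/-- `W = (P₁ + ⋯ + P_{s+1}) - (Q₁ + ⋯ + Q_s)` with perfect matchings `Pᵢ` and `Qᵢ`. -/
def IsMatchingDecomposition (W : (Fin 2 → ℤ) → ℤ) {s : ℕ}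
    (P : Fin (s + 1) → (Fin 2 → ℤ) → ℤ) (Q : Fin s → (Fin 2 → ℤ) → ℤ) : Prop :=
  (∀ i, IsPerfectMatching (P i)) ∧ (∀ i, IsPerfectMatching (Q i)) ∧
    ∀ a, W a = ∑ i, P i a - ∑ i, Q i a

/-! ### `k`-diagrams -/

/-- A `k`-diagram: five `k`-vector spaces and four linear maps
`B₁ → A₁ ← B₃ → A₂ ← B₂`. -/
structure KDiagram (k : Type u) [Field k] : Type (u + 1) where
  (B₁ B₂ B₃ A₁ A₂ : Type u)
  [grpB₁ : AddCommGroup B₁] [grpB₂ : AddCommGroup B₂] [grpB₃ : AddCommGroup B₃]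
  [grpA₁ : AddCommGroup A₁] [grpA₂ : AddCommGroup A₂]
  [modB₁ : Module k B₁] [modB₂ : Module k B₂] [modB₃ : Module k B₃]
  [modA₁ : Module k A₁] [modA₂ : Module k A₂]
  ρ₁₁ : B₁ →ₗ[k] A₁
  ρ₂₂ : B₂ →ₗ[k] A₂
  ρ₃₁ : B₃ →ₗ[k] A₁
  ρ₃₂ : B₃ →ₗ[k] A₂

attribute [instance] KDiagram.grpB₁ KDiagram.grpB₂ KDiagram.grpB₃ KDiagram.grpA₁ KDiagram.grpA₂
  KDiagram.modB₁ KDiagram.modB₂ KDiagram.modB₃ KDiagram.modA₁ KDiagram.modA₂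

namespace KDiagram

variable {k : Type u} [Field k]

/-- The differential `(b₁, b₂, b₃) ↦ (ρ₁₁ b₁ - ρ₃₁ b₃, ρ₂₂ b₂ - ρ₃₂ b₃)`. -/
def differential (F : KDiagram k) : (F.B₁ × F.B₂ × F.B₃) →ₗ[k] (F.A₁ × F.A₂) where
  toFun b := (F.ρ₁₁ b.1 - F.ρ₃₁ b.2.2, F.ρ₂₂ b.2.1 - F.ρ₃₂ b.2.2)
  map_add' x y := by
    simp only [Prod.fst_add, Prod.snd_add, map_add, Prod.mk_add_mk]
    congr 1 <;> abel
  map_smul' c x := by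
    simp [smul_sub]

/-- `H⁰`, the kernel of the differential. -/
abbrev H0 (F : KDiagram k) : Type u := LinearMap.ker F.differential

/-- `H¹`, the cokernel of the differential. -/
abbrev H1 (F : KDiagram k) : Type u := (F.A₁ × F.A₂) ⧸ LinearMap.range F.differential

/-- Both cohomology groups are finite dimensional. -/
def IsFredholm (F : KDiagram k) : Prop :=
  Module.Finite k F.H0 ∧ Module.Finite k F.H1

/-- An isomorphism of `k`-diagrams. -/
structure Iso (F G : KDiagram k) where
  b₁ : F.B₁ ≃ₗ[k] G.B₁
  b₂ : F.B₂ ≃ₗ[k] G.B₂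
  b₃ : F.B₃ ≃ₗ[k] G.B₃
  a₁ : F.A₁ ≃ₗ[k] G.A₁
  a₂ : F.A₂ ≃ₗ[k] G.A₂
  comm₁₁ : ∀ x, G.ρ₁₁ (b₁ x) = a₁ (F.ρ₁₁ x)
  comm₂₂ : ∀ x, G.ρ₂₂ (b₂ x) = a₂ (F.ρ₂₂ x)
  comm₃₁ : ∀ x, G.ρ₃₁ (b₃ x) = a₁ (F.ρ₃₁ x)
  comm₃₂ : ∀ x, G.ρ₃₂ (b₃ x) = a₂ (F.ρ₃₂ x)

/-- The direct sum of two `k`-diagrams. -/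
def sum (F G : KDiagram k) : KDiagram k where
  B₁ := F.B₁ × G.B₁
  B₂ := F.B₂ × G.B₂
  B₃ := F.B₃ × G.B₃
  A₁ := F.A₁ × G.A₁
  A₂ := F.A₂ × G.A₂
  ρ₁₁ := F.ρ₁₁.prodMap G.ρ₁₁
  ρ₂₂ := F.ρ₂₂.prodMap G.ρ₂₂
  ρ₃₁ := F.ρ₃₁.prodMap G.ρ₃₁
  ρ₃₂ := F.ρ₃₂.prodMap G.ρ₃₂

/-- The zero `k`-diagram. -/
def zero (k : Type u) [Field k] : KDiagram k where
  B₁ := PUnit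
  B₂ := PUnit
  B₃ := PUnit
  A₁ := PUnit
  A₂ := PUnit
  ρ₁₁ := 0
  ρ₂₂ := 0
  ρ₃₁ := 0
  ρ₃₂ := 0

open scoped DirectSum in
/-- The direct sum of a family of `k`-diagrams. -/
noncomputable def directSum {ι : Type} (F : ι → KDiagram k) : KDiagram k where
  B₁ := ⨁ i, (F i).B₁
  B₂ := ⨁ i, (F i).B₂
  B₃ := ⨁ i, (F i).B₃
  A₁ := ⨁ i, (F i).A₁
  A₂ := ⨁ i, (F i).A₂
  ρ₁₁ := DirectSum.lmap fun i => (F i).ρ₁₁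
  ρ₂₂ := DirectSum.lmap fun i => (F i).ρ₂₂
  ρ₃₁ := DirectSum.lmap fun i => (F i).ρ₃₁
  ρ₃₂ := DirectSum.lmap fun i => (F i).ρ₃₂

namespace Iso

def refl (F : KDiagram k) : Iso F F where
  b₁ := .refl k _
  b₂ := .refl k _
  b₃ := .refl k _
  a₁ := .refl k _
  a₂ := .refl k _
  comm₁₁ _ := rfl
  comm₂₂ _ := rfl
  comm₃₁ _ := rfl
  comm₃₂ _ := rfl

def symm {F G : KDiagram k} (e : Iso F G) : Iso G F where
  b₁ := e.b₁.symm
  b₂ := e.b₂.symm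
  b₃ := e.b₃.symm
  a₁ := e.a₁.symm
  a₂ := e.a₂.symm
  comm₁₁ x := by rw [LinearEquiv.eq_symm_apply, ← e.comm₁₁, LinearEquiv.apply_symm_apply]
  comm₂₂ x := by rw [LinearEquiv.eq_symm_apply, ← e.comm₂₂, LinearEquiv.apply_symm_apply]
  comm₃₁ x := by rw [LinearEquiv.eq_symm_apply, ← e.comm₃₁, LinearEquiv.apply_symm_apply]
  comm₃₂ x := by rw [LinearEquiv.eq_symm_apply, ← e.comm₃₂, LinearEquiv.apply_symm_apply]

def trans {F G H : KDiagram k} (e : Iso F G) (e' : Iso G H) : Iso F H where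
  b₁ := e.b₁.trans e'.b₁
  b₂ := e.b₂.trans e'.b₂
  b₃ := e.b₃.trans e'.b₃
  a₁ := e.a₁.trans e'.a₁
  a₂ := e.a₂.trans e'.a₂
  comm₁₁ x := by simp [e.comm₁₁, e'.comm₁₁]
  comm₂₂ x := by simp [e.comm₂₂, e'.comm₂₂]
  comm₃₁ x := by simp [e.comm₃₁, e'.comm₃₁]
  comm₃₂ x := by simp [e.comm₃₂, e'.comm₃₂]

def sumCongr {F F' G G' : KDiagram k} (e : Iso F F') (e' : Iso G G') :
    Iso (F.sum G) (F'.sum G') where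
  b₁ := e.b₁.prodCongr e'.b₁
  b₂ := e.b₂.prodCongr e'.b₂
  b₃ := e.b₃.prodCongr e'.b₃
  a₁ := e.a₁.prodCongr e'.a₁
  a₂ := e.a₂.prodCongr e'.a₂
  comm₁₁ x := Prod.ext (e.comm₁₁ x.1) (e'.comm₁₁ x.2)
  comm₂₂ x := Prod.ext (e.comm₂₂ x.1) (e'.comm₂₂ x.2)
  comm₃₁ x := Prod.ext (e.comm₃₁ x.1) (e'.comm₃₁ x.2)
  comm₃₂ x := Prod.ext (e.comm₃₂ x.1) (e'.comm₃₂ x.2)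

def sumComm (F G : KDiagram k) : Iso (F.sum G) (G.sum F) where
  b₁ := LinearEquiv.prodComm k _ _
  b₂ := LinearEquiv.prodComm k _ _
  b₃ := LinearEquiv.prodComm k _ _
  a₁ := LinearEquiv.prodComm k _ _
  a₂ := LinearEquiv.prodComm k _ _
  comm₁₁ _ := rfl
  comm₂₂ _ := rfl
  comm₃₁ _ := rfl
  comm₃₂ _ := rfl

def sumAssoc (F G H : KDiagram k) : Iso ((F.sum G).sum H) (F.sum (G.sum H)) where
  b₁ := LinearEquiv.prodAssoc k _ _ _
  b₂ := LinearEquiv.prodAssoc k _ _ _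
  b₃ := LinearEquiv.prodAssoc k _ _ _
  a₁ := LinearEquiv.prodAssoc k _ _ _
  a₂ := LinearEquiv.prodAssoc k _ _ _
  comm₁₁ _ := rfl
  comm₂₂ _ := rfl
  comm₃₁ _ := rfl
  comm₃₂ _ := rfl

def unitProd (V : Type u) [AddCommGroup V] [Module k V] : (PUnit.{u + 1} × V) ≃ₗ[k] V where
  toFun x := x.2
  invFun x := (PUnit.unit, x)
  map_add' _ _ := rfl
  map_smul' _ _ := rfl
  left_inv _ := rfl
  right_inv _ := rfl

def zeroSum (F : KDiagram k) : Iso ((zero k).sum F) F where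
  b₁ := unitProd F.B₁
  b₂ := unitProd F.B₂
  b₃ := unitProd F.B₃
  a₁ := unitProd F.A₁
  a₂ := unitProd F.A₂
  comm₁₁ _ := rfl
  comm₂₂ _ := rfl
  comm₃₁ _ := rfl
  comm₃₂ _ := rfl

/-- An isomorphism of diagrams induces one of the domains of the differentials. -/
def eqvB {F G : KDiagram k} (e : Iso F G) :
    (F.B₁ × F.B₂ × F.B₃) ≃ₗ[k] (G.B₁ × G.B₂ × G.B₃) :=
  e.b₁.prodCongr (e.b₂.prodCongr e.b₃)

/-- An isomorphism of diagrams induces one of the codomains of the differentials. -/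
def eqvA {F G : KDiagram k} (e : Iso F G) : (F.A₁ × F.A₂) ≃ₗ[k] (G.A₁ × G.A₂) :=
  e.a₁.prodCongr e.a₂

theorem differential_eqvB {F G : KDiagram k} (e : Iso F G) (x : F.B₁ × F.B₂ × F.B₃) :
    G.differential (e.eqvB x) = e.eqvA (F.differential x) := by
  simp [differential, eqvB, eqvA, e.comm₁₁, e.comm₂₂, e.comm₃₁, e.comm₃₂]

def eqvH0 {F G : KDiagram k} (e : Iso F G) : F.H0 ≃ₗ[k] G.H0 :=
  e.eqvB.ofSubmodules _ _ (by
    ext y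
    simp only [Submodule.mem_map, LinearMap.mem_ker]
    constructor
    · rintro ⟨x, hx, rfl⟩
      have := e.differential_eqvB x
      rw [hx, map_zero] at this
      exact this
    · intro hy
      refine ⟨e.eqvB.symm y, ?_, e.eqvB.apply_symm_apply y⟩
      have := e.differential_eqvB (e.eqvB.symm y)
      rw [e.eqvB.apply_symm_apply, hy] at this
      exact (LinearEquiv.map_eq_zero_iff _).1 this.symm)

noncomputable def eqvH1 {F G : KDiagram k} (e : Iso F G) : F.H1 ≃ₗ[k] G.H1 :=
  Submodule.Quotient.equiv _ _ e.eqvA (by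
    ext y
    simp only [Submodule.mem_map, LinearMap.mem_range]
    constructor
    · rintro ⟨_, ⟨x, rfl⟩, rfl⟩
      exact ⟨e.eqvB x, e.differential_eqvB x⟩
    · rintro ⟨x, rfl⟩
      refine ⟨_, ⟨e.eqvB.symm x, rfl⟩, ?_⟩
      have := e.differential_eqvB (e.eqvB.symm x)
      rw [e.eqvB.apply_symm_apply] at this
      exact this.symm)

end Iso

def sumH0 (F G : KDiagram k) : (F.sum G).H0 ≃ₗ[k] (F.H0 × G.H0) where
  toFun x :=
    (⟨(x.1.1.1, x.1.2.1.1, x.1.2.2.1), by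
        have h := x.2
        rw [LinearMap.mem_ker] at h
        exact Prod.ext (congrArg (fun y => y.1.1) h) (congrArg (fun y => y.2.1) h)⟩,
     ⟨(x.1.1.2, x.1.2.1.2, x.1.2.2.2), by
        have h := x.2
        rw [LinearMap.mem_ker] at h
        exact Prod.ext (congrArg (fun y => y.1.2) h) (congrArg (fun y => y.2.2) h)⟩)
  invFun y :=
    ⟨((y.1.1.1, y.2.1.1), (y.1.1.2.1, y.2.1.2.1), (y.1.1.2.2, y.2.1.2.2)), by
      have h : F.differential y.1.1 = 0 := y.1.2
      have h' : G.differential y.2.1 = 0 := y.2.2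
      change _ = ((0, 0), (0, 0))
      have h₁ := congrArg Prod.fst h
      have h₂ := congrArg Prod.snd h
      have h₁' := congrArg Prod.fst h'
      have h₂' := congrArg Prod.snd h'
      exact Prod.ext (Prod.ext h₁ h₁') (Prod.ext h₂ h₂')⟩
  map_add' _ _ := rfl
  map_smul' _ _ := rfl
  left_inv _ := rfl
  right_inv _ := rfl

noncomputable def sumH1 (F G : KDiagram k) : (F.sum G).H1 ≃ₗ[k] (F.H1 × G.H1) :=
  let φ : ((F.sum G).A₁ × (F.sum G).A₂) →ₗ[k] (F.H1 × G.H1) :=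
    ((LinearMap.range F.differential).mkQ.prodMap (LinearMap.range G.differential).mkQ).comp
      (LinearEquiv.prodProdProdComm k F.A₁ G.A₁ F.A₂ G.A₂).toLinearMap
  (Submodule.quotEquivOfEq (LinearMap.range (F.sum G).differential) (LinearMap.ker φ) (by
    ext y
    have hy : y ∈ LinearMap.ker φ ↔ (y.1.1, y.2.1) ∈ LinearMap.range F.differential ∧
        (y.1.2, y.2.2) ∈ LinearMap.range G.differential := by
      refine (Prod.ext_iff (x := φ y) (y := 0)).trans (and_congr ?_ ?_)
      · exact Submodule.Quotient.mk_eq_zero (LinearMap.range F.differential)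
      · exact Submodule.Quotient.mk_eq_zero (LinearMap.range G.differential)
    refine Iff.trans ?_ hy.symm
    constructor
    · rintro ⟨x, rfl⟩
      exact ⟨⟨(x.1.1, x.2.1.1, x.2.2.1), rfl⟩, ⟨(x.1.2, x.2.1.2, x.2.2.2), rfl⟩⟩
    · rintro ⟨⟨x, hx⟩, ⟨x', hx'⟩⟩
      refine ⟨((x.1, x'.1), (x.2.1, x'.2.1), (x.2.2, x'.2.2)), ?_⟩
      have h₁ := congrArg Prod.fst hx
      have h₂ := congrArg Prod.snd hx
      have h₁' := congrArg Prod.fst hx'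
      have h₂' := congrArg Prod.snd hx'
      exact Prod.ext (Prod.ext h₁ h₁') (Prod.ext h₂ h₂'))).trans
  (φ.quotKerEquivOfSurjective (by
    rintro ⟨x, y⟩
    obtain ⟨x, rfl⟩ := Submodule.Quotient.mk_surjective _ x
    obtain ⟨y, rfl⟩ := Submodule.Quotient.mk_surjective _ y
    exact ⟨((x.1, y.1), (x.2, y.2)), rfl⟩))

theorem IsFredholm.sum {F G : KDiagram k} (hF : F.IsFredholm) (hG : G.IsFredholm) :
    (F.sum G).IsFredholm := by
  obtain ⟨h0, h1⟩ := hF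
  obtain ⟨g0, g1⟩ := hG
  exact ⟨Module.Finite.equiv (sumH0 F G).symm, Module.Finite.equiv (sumH1 F G).symm⟩

theorem isFredholm_zero : (zero k).IsFredholm := by
  refine ⟨?_, ?_⟩
  · have : Subsingleton ((zero k).B₁ × (zero k).B₂ × (zero k).B₃) :=
      inferInstanceAs (Subsingleton (PUnit × PUnit × PUnit))
    infer_instance
  · have : Subsingleton ((zero k).A₁ × (zero k).A₂) :=
      inferInstanceAs (Subsingleton (PUnit × PUnit))
    have : Module.Finite k ((zero k).A₁ × (zero k).A₂) := inferInstance
    infer_instance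

end KDiagram

/-! ### Virtual `k`-diagrams -/

/-- Fredholm `k`-diagrams. -/
def FredholmDiagram (k : Type u) [Field k] : Type (u + 1) :=
  {F : KDiagram k // F.IsFredholm}

instance FredholmDiagram.setoid (k : Type u) [Field k] : Setoid (FredholmDiagram k) where
  r F G := Nonempty (KDiagram.Iso F.1 G.1)
  iseqv :=
    { refl := fun F => ⟨.refl F.1⟩
      symm := fun ⟨e⟩ => ⟨e.symm⟩
      trans := fun ⟨e⟩ ⟨e'⟩ => ⟨e.trans e'⟩ }

/-- Isomorphism classes of Fredholm `k`-diagrams. -/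
def FredholmClass (k : Type u) [Field k] : Type (u + 1) :=
  Quotient (FredholmDiagram.setoid k)

namespace FredholmClass

variable {k : Type u} [Field k]

/-- The isomorphism class of a Fredholm `k`-diagram. -/
def of (F : KDiagram k) (hF : F.IsFredholm) : FredholmClass k :=
  Quotient.mk (FredholmDiagram.setoid k) ⟨F, hF⟩

theorem of_eq_of_iff {F G : KDiagram k} {hF : F.IsFredholm} {hG : G.IsFredholm} :
    of F hF = of G hG ↔ Nonempty (F.Iso G) :=
  ⟨fun h => Quotient.exact h, fun h => Quotient.sound h⟩

instance : Add (FredholmClass k) where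
  add := Quotient.map₂ (fun F G => ⟨F.1.sum G.1, F.2.sum G.2⟩)
    (fun _ _ ⟨e⟩ _ _ ⟨e'⟩ => ⟨e.sumCongr e'⟩)

instance : Zero (FredholmClass k) where
  zero := of (KDiagram.zero k) KDiagram.isFredholm_zero

/-- The commutative monoid of isomorphism classes of Fredholm `k`-diagrams under direct sum. -/
instance : AddCommMonoid (FredholmClass k) where
  add_assoc := by
    rintro ⟨F⟩ ⟨G⟩ ⟨H⟩
    exact Quotient.sound ⟨.sumAssoc F.1 G.1 H.1⟩
  add_comm := by
    rintro ⟨F⟩ ⟨G⟩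
    exact Quotient.sound ⟨.sumComm F.1 G.1⟩
  zero_add := by
    rintro ⟨F⟩
    exact Quotient.sound ⟨.zeroSum F.1⟩
  add_zero := by
    rintro ⟨F⟩
    exact Quotient.sound ⟨(KDiagram.Iso.sumComm F.1 (KDiagram.zero k)).trans (.zeroSum F.1)⟩
  nsmul := nsmulRec

theorem of_add_of (F G : KDiagram k) (hF : F.IsFredholm) (hG : G.IsFredholm) :
    of F hF + of G hG = of (F.sum G) (hF.sum hG) := rfl

/-- The map `F ↦ dim H⁰(F)` on isomorphism classes, as an additive map to `ℤ`. -/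
noncomputable def betti0 : FredholmClass k →+ ℤ where
  toFun := Quotient.lift (fun F => (Module.finrank k F.1.H0 : ℤ))
    (fun _ _ ⟨e⟩ => congrArg Nat.cast e.eqvH0.finrank_eq)
  map_zero' := by
    have : Subsingleton ((KDiagram.zero k).B₁ × (KDiagram.zero k).B₂ × (KDiagram.zero k).B₃) :=
      inferInstanceAs (Subsingleton (PUnit × PUnit × PUnit))
    exact congrArg Nat.cast (Module.finrank_zero_of_subsingleton (R := k))
  map_add' := by
    rintro ⟨F⟩ ⟨G⟩
    have := F.2.1
    have := G.2.1
    have h : Module.finrank k (F.1.sum G.1).H0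
        = Module.finrank k F.1.H0 + Module.finrank k G.1.H0 := by
      rw [(KDiagram.sumH0 F.1 G.1).finrank_eq, Module.finrank_prod]
    exact (congrArg (Nat.cast (R := ℤ)) h).trans (Nat.cast_add _ _)

/-- The map `F ↦ dim H¹(F)` on isomorphism classes, as an additive map to `ℤ`. -/
noncomputable def betti1 : FredholmClass k →+ ℤ where
  toFun := Quotient.lift (fun F => (Module.finrank k F.1.H1 : ℤ))
    (fun _ _ ⟨e⟩ => congrArg Nat.cast e.eqvH1.finrank_eq)
  map_zero' := by
    have : Subsingleton ((KDiagram.zero k).A₁ × (KDiagram.zero k).A₂) :=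
      inferInstanceAs (Subsingleton (PUnit × PUnit))
    have : Subsingleton (KDiagram.zero k).H1 :=
      (Submodule.Quotient.mk_surjective _).subsingleton
    exact congrArg Nat.cast (Module.finrank_zero_of_subsingleton (R := k))
  map_add' := by
    rintro ⟨F⟩ ⟨G⟩
    have := F.2.2
    have := G.2.2
    have h : Module.finrank k (F.1.sum G.1).H1
        = Module.finrank k F.1.H1 + Module.finrank k G.1.H1 := by
      rw [(KDiagram.sumH1 F.1 G.1).finrank_eq, Module.finrank_prod]
    exact (congrArg (Nat.cast (R := ℤ)) h).trans (Nat.cast_add _ _)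

end FredholmClass

/-- Equivalence classes of virtual (Fredholm) `k`-diagrams: the Grothendieck group of the
commutative monoid of isomorphism classes of Fredholm `k`-diagrams. -/
abbrev VirtualDiagram (k : Type u) [Field k] : Type (u + 1) :=
  Algebra.GrothendieckAddGroup (FredholmClass k)

namespace VirtualDiagram

variable {k : Type u} [Field k]

/-- The class `[F ⊖ G]` of a formal difference of Fredholm `k`-diagrams. -/
noncomputable def mk (F G : KDiagram k) (hF : F.IsFredholm) (hG : G.IsFredholm) :
    VirtualDiagram k :=
  Algebra.GrothendieckAddGroup.of (FredholmClass.of F hF) -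
    Algebra.GrothendieckAddGroup.of (FredholmClass.of G hG)

/-- `[F₁ ⊖ G₁] = [F₂ ⊖ G₂]` iff `F₁ ⊕ G₂ ⊕ H ≃ F₂ ⊕ G₁ ⊕ H` for some Fredholm `H`. -/
theorem mk_eq_mk_iff {F₁ G₁ F₂ G₂ : KDiagram k} {hF₁ : F₁.IsFredholm} {hG₁ : G₁.IsFredholm}
    {hF₂ : F₂.IsFredholm} {hG₂ : G₂.IsFredholm} :
    mk F₁ G₁ hF₁ hG₁ = mk F₂ G₂ hF₂ hG₂ ↔
      ∃ H : KDiagram k, H.IsFredholm ∧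
        Nonempty (((F₁.sum G₂).sum H).Iso ((F₂.sum G₁).sum H)) := by
  have key : mk F₁ G₁ hF₁ hG₁ = mk F₂ G₂ hF₂ hG₂ ↔ ∃ c : FredholmClass k,
      FredholmClass.of F₁ hF₁ + FredholmClass.of G₂ hG₂ + c =
        FredholmClass.of F₂ hF₂ + FredholmClass.of G₁ hG₁ + c := by
    unfold mk
    rw [sub_eq_sub_iff_add_eq_add, ← map_add, ← map_add]
    refine (AddSubmonoid.LocalizationMap.eq_iff_exists
      (AddLocalization.addMonoidOf (⊤ : AddSubmonoid (FredholmClass k)))).trans ?_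
    constructor
    · rintro ⟨c, hc⟩
      exact ⟨c.1, by simpa only [add_comm] using hc⟩
    · rintro ⟨c, hc⟩
      exact ⟨⟨c, AddSubmonoid.mem_top c⟩, by simpa only [add_comm] using hc⟩
  rw [key]
  constructor
  · rintro ⟨⟨H⟩, hc⟩
    exact ⟨H.1, H.2, FredholmClass.of_eq_of_iff.1 hc⟩
  · rintro ⟨H, hH, e⟩
    exact ⟨FredholmClass.of H hH, FredholmClass.of_eq_of_iff.2 e⟩

/-- The zeroth Betti number `b⁰([F ⊖ G]) = dim H⁰(F) - dim H⁰(G)`. -/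
noncomputable def b0 (c : VirtualDiagram k) : ℤ :=
  Algebra.GrothendieckAddGroup.lift FredholmClass.betti0 c

/-- The first Betti number `b¹([F ⊖ G]) = dim H¹(F) - dim H¹(G)`. -/
noncomputable def b1 (c : VirtualDiagram k) : ℤ :=
  Algebra.GrothendieckAddGroup.lift FredholmClass.betti1 c

/-- The Euler characteristic `b⁰ - b¹`. -/
noncomputable def eulerChar (c : VirtualDiagram k) : ℤ := c.b0 - c.b1

theorem b0_mk (F G : KDiagram k) (hF : F.IsFredholm) (hG : G.IsFredholm) :
    (mk F G hF hG).b0 = Module.finrank k F.H0 - Module.finrank k G.H0 := by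
  have h : ∀ x : FredholmClass k, Algebra.GrothendieckAddGroup.lift FredholmClass.betti0
      (Algebra.GrothendieckAddGroup.of x) = FredholmClass.betti0 x := fun x =>
    DFunLike.congr_fun
      (Algebra.GrothendieckAddGroup.lift.symm_apply_apply FredholmClass.betti0) x
  unfold b0 mk
  rw [map_sub, h, h]
  rfl

theorem b1_mk (F G : KDiagram k) (hF : F.IsFredholm) (hG : G.IsFredholm) :
    (mk F G hF hG).b1 = Module.finrank k F.H1 - Module.finrank k G.H1 := by
  have h : ∀ x : FredholmClass k, Algebra.GrothendieckAddGroup.lift FredholmClass.betti1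
      (Algebra.GrothendieckAddGroup.of x) = FredholmClass.betti1 x := fun x =>
    DFunLike.congr_fun
      (Algebra.GrothendieckAddGroup.lift.symm_apply_apply FredholmClass.betti1) x
  unfold b1 mk
  rw [map_sub, h, h]
  rfl

/-- `F` and `G` are Fredholm and `c` is the class of the virtual `k`-diagram `F ⊖ G`. -/
def IsClassOf (c : VirtualDiagram k) (F G : KDiagram k) : Prop :=
  ∃ (hF : F.IsFredholm) (hG : G.IsFredholm), c = mk F G hF hG

end VirtualDiagram

/-! ### The diagrams attached to a weight -/

/-- The multiset on `ℤ²` with multiplicities `W`, as the set of all `(a, m)` with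
`1 ≤ m ≤ W(a)` (used for nonnegative `W`). -/
def MultiSupport (W : (Fin 2 → ℤ) → ℤ) : Type :=
  {x : (Fin 2 → ℤ) × ℕ // 1 ≤ x.2 ∧ (x.2 : ℤ) ≤ W x.1}

/-- The `k`-diagram `𝓜_{W,d}` of a nonnegative `W`. -/
noncomputable def matchingDiagram (k : Type u) [Field k] (W : (Fin 2 → ℤ) → ℤ)
    (d : Fin 2 → ℤ) : KDiagram k where
  B₁ := Set.Iic (d 0) →₀ k
  B₂ := Set.Iic (d 1) →₀ k
  B₃ := MultiSupport W →₀ k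
  A₁ := ℤ →₀ k
  A₂ := ℤ →₀ k
  ρ₁₁ := Finsupp.lmapDomain k k Subtype.val
  ρ₂₂ := Finsupp.lmapDomain k k Subtype.val
  ρ₃₁ := Finsupp.lmapDomain k k fun x => x.1.1 0
  ρ₃₂ := Finsupp.lmapDomain k k fun x => x.1.1 1

/-- The indicator `k`-diagram `𝓘_{d ≥ a}`: its values at `B₃, A₁, A₂` are `k`, its value at `Bⱼ`
for `j = 1, 2` is `k` if `aⱼ ≤ dⱼ` and `0` otherwise, and its maps are identities and
inclusions. -/
noncomputable def indicatorDiagram (k : Type u) [Field k] (d a : Fin 2 → ℤ) : KDiagram k where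
  B₁ := (if a 0 ≤ d 0 then ⊤ else ⊥ : Submodule k k)
  B₂ := (if a 1 ≤ d 1 then ⊤ else ⊥ : Submodule k k)
  B₃ := k
  A₁ := k
  A₂ := k
  ρ₁₁ := Submodule.subtype _
  ρ₂₂ := Submodule.subtype _
  ρ₃₁ := LinearMap.id
  ρ₃₂ := LinearMap.id

/-- The direct sum `𝓘_d^{⊕W}` of `W(a)` copies of `𝓘_{d ≥ a}` over all `a ∈ ℤ²`, for a
nonnegative `W`. -/
noncomputable def indicatorSum (k : Type u) [Field k] (W : (Fin 2 → ℤ) → ℤ) (d : Fin 2 → ℤ) :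
    KDiagram k :=
  KDiagram.directSum fun x : MultiSupport W => indicatorDiagram k d x.1.1

/-- `c` is the class `[𝓜_{W,d}]` of the weight `W` of a Riemann function `ℤ² → ℤ`: it is the class
of `(⊕ᵢ 𝓜_{Pᵢ,d}) ⊖ (⊕ᵢ 𝓜_{Qᵢ,d})` for every expression of `W` as a difference of sums
`∑ Pᵢ - ∑ Qᵢ` of perfect matchings, and it is the class of `𝓘_d^{⊕W⁺} ⊖ 𝓘_d^{⊕W⁻}`. The second
description makes sense also if `W` is unbounded and there is no such expression. -/
structure IsWeightClass {k : Type u} [Field k] (W : (Fin 2 → ℤ) → ℤ) (d : Fin 2 → ℤ)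
    (c : VirtualDiagram k) : Prop where
  of_matchings : ∀ (s : ℕ) (P : Fin (s + 1) → (Fin 2 → ℤ) → ℤ) (Q : Fin s → (Fin 2 → ℤ) → ℤ),
    IsMatchingDecomposition W P Q →
      c.IsClassOf (KDiagram.directSum fun i => matchingDiagram k (P i) d)
        (KDiagram.directSum fun i => matchingDiagram k (Q i) d)
  of_indicators : c.IsClassOf (indicatorSum k (fun a => max (W a) 0) d)
    (indicatorSum k (fun a => max (-W a) 0) d)

/-- `c` is the class `[𝓜_{f;i,j,d}]`, i.e. `[𝓜_{W,0}]` for the weight `W` of the two-variable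
restriction `f_{i,j,d}`. -/
def IsVirtualDiagramAtCoords {k : Type u} [Field k] {n : ℕ} (f : (Fin n → ℤ) → ℤ)
    (i j : Fin n) (d : Fin n → ℤ) (c : VirtualDiagram k) : Prop :=
  ∃ W, IsWeight (twoVarRestriction f i j d) W ∧ IsWeightClass W 0 c

/-- `c` is the class `[𝓜_{f at d}]`: for every choice of distinct `i, j` the class
`[𝓜_{f;i,j,d}]` exists, is uniquely determined, and equals `c`. -/
def IsVirtualDiagramAt {k : Type u} [Field k] {n : ℕ} (f : (Fin n → ℤ) → ℤ)
    (d : Fin n → ℤ) (c : VirtualDiagram k) : Prop :=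
  ∀ i j : Fin n, i ≠ j →
    ∀ x : VirtualDiagram k, IsVirtualDiagramAtCoords f i j d x ↔ x = c

/-! All classes are computed in the Grothendieck group and turn out to depend on two integers only.
An acyclic diagram F, one with bijective differential, has class zero: a countable sum S of copies
of F is again acyclic, hence Fredholm, and F ⊕ S ≃ S (`KDiagram.IsAcyclic.hasClass`). The indicator
diagram at a (for d = 0) is acyclic except when a ≤ 0, where it has a class α with (b⁰, b¹) = (1,
0), and when both coordinates of a are positive, where it has a class β with (b⁰, b¹) = (0, 1). So
the indicator sum of an initially and eventually zero W ≥ 0 has class p α + q β, where p and q are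
the finite sums of W over a ≤ 0 and over the positive quadrant (`hasClass_indicatorSum`); the other,
possibly infinitely many, summands contribute zero. The diagram of a perfect matching is the
indicator sum of its points, because both projections to ℤ are bijective (`matchingDiagramIso`).
Since p and q are additive in W, every presentation of W yields the same class.

The weight of a function of two variables is its mixed second difference, whose sums telescope. For
the restriction of f at d this gives p = f(d) and q = f(d) - deg(d) - C, independently of i and j;
Betti numbers and duality are then read off.

For decompositions into matchings, such a weight lives in a strip around the antidiagonal and has
all row and column sums 1. If |W| ≤ B, adding B copies of each antidiagonal of the strip makes it a
nonnegative matrix with constant row and column sums, which is a sum of permutation matrices by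
Hall's theorem and a Schröder–Bernstein argument (`exists_perms_of_regular`). -/

namespace KDiagram

/-! ### Acyclic `k`-diagrams. -/

variable {k : Type u} [Field k]

/-- A `k`-diagram is acyclic if its differential is bijective. -/
def IsAcyclic (F : KDiagram k) : Prop := Function.Bijective F.differential

theorem IsAcyclic.isFredholm {F : KDiagram k} (h : F.IsAcyclic) : F.IsFredholm := by
  constructor
  · have : Subsingleton F.H0 :=
      Submodule.subsingleton_iff_eq_bot.2 (LinearMap.ker_eq_bot.2 h.1)
    infer_instance
  · have : Subsingleton F.H1 :=
      Submodule.Quotient.subsingleton_iff.2 (LinearMap.range_eq_top.2 h.2)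
    infer_instance

theorem IsFredholm.of_iso {F G : KDiagram k} (e : F.Iso G) (hF : F.IsFredholm) :
    G.IsFredholm := by
  obtain ⟨h0, h1⟩ := hF
  exact ⟨Module.Finite.equiv e.eqvH0, Module.Finite.equiv e.eqvH1⟩

theorem isAcyclic_of_subsingleton (F : KDiagram k) [Subsingleton F.B₁] [Subsingleton F.B₂]
    [Subsingleton F.B₃] [Subsingleton F.A₁] [Subsingleton F.A₂] : F.IsAcyclic :=
  ⟨fun _ _ _ => Subsingleton.elim _ _, fun _ => ⟨0, Subsingleton.elim _ _⟩⟩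

/-! ### Direct sums over arbitrary index types. -/

section DirectSum

variable {ι κ : Type}

open scoped DirectSum

/-- Reindexing a direct sum of `k`-diagrams. -/
noncomputable def Iso.directSumReindex (e : ι ≃ κ) (F : ι → KDiagram k) :
    (directSum F).Iso (directSum fun j => F (e.symm j)) where
  b₁ := DirectSum.lequivCongrLeft k e
  b₂ := DirectSum.lequivCongrLeft k e
  b₃ := DirectSum.lequivCongrLeft k e
  a₁ := DirectSum.lequivCongrLeft k e
  a₂ := DirectSum.lequivCongrLeft k e
  comm₁₁ _ := DFinsupp.ext fun _ => rfl
  comm₂₂ _ := DFinsupp.ext fun _ => rfl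
  comm₃₁ _ := DFinsupp.ext fun _ => rfl
  comm₃₂ _ := DFinsupp.ext fun _ => rfl

/-- Splitting off one summand of a direct sum of `k`-diagrams. -/
noncomputable def Iso.directSumOption (F : Option ι → KDiagram k) :
    (directSum F).Iso ((F none).sum (directSum fun i => F (some i))) where
  b₁ := DirectSum.lequivProdDirectSum k
  b₂ := DirectSum.lequivProdDirectSum k
  b₃ := DirectSum.lequivProdDirectSum k
  a₁ := DirectSum.lequivProdDirectSum k
  a₂ := DirectSum.lequivProdDirectSum k
  comm₁₁ _ := Prod.ext rfl (DFinsupp.ext fun _ => rfl)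
  comm₂₂ _ := Prod.ext rfl (DFinsupp.ext fun _ => rfl)
  comm₃₁ _ := Prod.ext rfl (DFinsupp.ext fun _ => rfl)
  comm₃₂ _ := Prod.ext rfl (DFinsupp.ext fun _ => rfl)

open Classical in
/-- A direct sum of modules is the product of the partial sums over a set of indices and over its
complement. -/
noncomputable def directSumSplit (M : ι → Type u) [∀ i, AddCommGroup (M i)]
    [∀ i, Module k (M i)] (p : ι → Prop) :
    (⨁ i, M i) ≃ₗ[k] (⨁ i : {i // p i}, M i) × (⨁ i : {i // ¬ p i}, M i) :=
  LinearEquiv.ofBijective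
    ((DFinsupp.subtypeDomainLinearMap k M p).prod
      (DFinsupp.subtypeDomainLinearMap k M fun i => ¬ p i)) (by
    set φ := (DFinsupp.subtypeDomainLinearMap k M p).prod
      (DFinsupp.subtypeDomainLinearMap k M fun i => ¬ p i)
    constructor
    · intro x y h
      refine DFinsupp.ext fun i => ?_
      by_cases hi : p i
      · exact DFunLike.congr_fun (congrArg Prod.fst h) ⟨i, hi⟩
      · exact DFunLike.congr_fun (congrArg Prod.snd h) ⟨i, hi⟩
    -- The range is a submodule, so it suffices to reach (x, 0) and (0, y), and by induction only
    -- those with x or y homogeneous.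
    · rw [← LinearMap.range_eq_top, eq_top_iff]
      rintro ⟨x, y⟩ -
      have hx : (x, (0 : ⨁ i : {i // ¬ p i}, M i)) ∈ LinearMap.range φ := by
        induction x using DirectSum.induction_on with
        | zero => exact Submodule.zero_mem _
        | of i m =>
          refine ⟨DFinsupp.single i.1 m, Prod.ext (DFinsupp.ext fun j => ?_)
            (DFinsupp.ext fun j => ?_)⟩
          · change DFinsupp.single i.1 m j.1 =
              DFinsupp.single (β := fun i : {i // p i} => M i) i m j
            by_cases h : i = j
            · subst h; simp
            · rw [DFinsupp.single_eq_of_ne (Ne.symm h)]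
              exact DFinsupp.single_eq_of_ne fun h' => h (Subtype.ext h'.symm)
          · exact DFinsupp.single_eq_of_ne (β := M) (i := i.1) (i' := j.1)
              fun h' => j.2 (h'.symm ▸ i.2)
        | add a b ha hb => simpa using Submodule.add_mem _ ha hb
      have hy : ((0 : ⨁ i : {i // p i}, M i), y) ∈ LinearMap.range φ := by
        induction y using DirectSum.induction_on with
        | zero => exact Submodule.zero_mem _
        | of i m =>
          refine ⟨DFinsupp.single i.1 m, Prod.ext (DFinsupp.ext fun j => ?_)
            (DFinsupp.ext fun j => ?_)⟩
          · exact DFinsupp.single_eq_of_ne (β := M) (i := i.1) (i' := j.1)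
              fun h' => i.2 (h' ▸ j.2)
          · change DFinsupp.single i.1 m j.1 =
              DFinsupp.single (β := fun i : {i // ¬ p i} => M i) i m j
            by_cases h : i = j
            · subst h; simp
            · rw [DFinsupp.single_eq_of_ne (Ne.symm h)]
              exact DFinsupp.single_eq_of_ne fun h' => h (Subtype.ext h'.symm)
        | add a b ha hb => simpa using Submodule.add_mem _ ha hb
      simpa using Submodule.add_mem _ hx hy)

/-- A direct sum of `k`-diagrams is the sum of the partial sums over a set of indices and over its
complement. -/
noncomputable def Iso.directSumSplit (F : ι → KDiagram k) (p : ι → Prop) :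
    (directSum F).Iso
      ((directSum fun i : {i // p i} => F i).sum (directSum fun i : {i // ¬ p i} => F i)) where
  b₁ := KDiagram.directSumSplit _ p
  b₂ := KDiagram.directSumSplit _ p
  b₃ := KDiagram.directSumSplit _ p
  a₁ := KDiagram.directSumSplit _ p
  a₂ := KDiagram.directSumSplit _ p
  comm₁₁ _ := Prod.ext (DFinsupp.ext fun _ => rfl) (DFinsupp.ext fun _ => rfl)
  comm₂₂ _ := Prod.ext (DFinsupp.ext fun _ => rfl) (DFinsupp.ext fun _ => rfl)
  comm₃₁ _ := Prod.ext (DFinsupp.ext fun _ => rfl) (DFinsupp.ext fun _ => rfl)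
  comm₃₂ _ := Prod.ext (DFinsupp.ext fun _ => rfl) (DFinsupp.ext fun _ => rfl)

-- The index type may be infinite: both the swindle and the disposal of the acyclic summands of an
-- indicator sum need this. Injectivity is checked componentwise, surjectivity on homogeneous
-- elements.
open Classical in
theorem IsAcyclic.directSum {F : ι → KDiagram k} (h : ∀ i, (F i).IsAcyclic) :
    (directSum F).IsAcyclic := by
  constructor
  · rw [← LinearMap.ker_eq_bot, LinearMap.ker_eq_bot']
    rintro ⟨x, y, z⟩ hx
    change (⨁ i, (F i).B₁) at x
    change (⨁ i, (F i).B₂) at y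
    change (⨁ i, (F i).B₃) at z
    have hx₁ : DirectSum.lmap (fun i => (F i).ρ₁₁) x - DirectSum.lmap (fun i => (F i).ρ₃₁) z = 0 :=
      congrArg Prod.fst hx
    have hx₂ : DirectSum.lmap (fun i => (F i).ρ₂₂) y - DirectSum.lmap (fun i => (F i).ρ₃₂) z = 0 :=
      congrArg Prod.snd hx
    have key : ∀ i, (x i, y i, z i) = (0 : (F i).B₁ × (F i).B₂ × (F i).B₃) := fun i => by
      refine LinearMap.ker_eq_bot'.1 (LinearMap.ker_eq_bot.2 (h i).1) _ ?_
      exact Prod.ext (DFunLike.congr_fun hx₁ i)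
        (DFunLike.congr_fun hx₂ i)
    refine Prod.ext (DFinsupp.ext fun i => ?_) (Prod.ext (DFinsupp.ext fun i => ?_)
      (DFinsupp.ext fun i => ?_))
    · exact congrArg Prod.fst (key i)
    · exact congrArg (fun w => w.2.1) (key i)
    · exact congrArg (fun w => w.2.2) (key i)
  · rw [← LinearMap.range_eq_top, eq_top_iff]
    have single : ∀ i (a : (F i).A₁) (b : (F i).A₂),
        ((DirectSum.lof k ι (fun i => (F i).A₁) i a, DirectSum.lof k ι (fun i => (F i).A₂) i b) :
          (KDiagram.directSum F).A₁ × (KDiagram.directSum F).A₂) ∈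
            LinearMap.range (KDiagram.directSum F).differential := by
      intro i a b
      obtain ⟨⟨x, y, z⟩, hx⟩ := (h i).2 (a, b)
      refine ⟨(DirectSum.lof k ι (fun i => (F i).B₁) i x,
        DirectSum.lof k ι (fun i => (F i).B₂) i y, DirectSum.lof k ι (fun i => (F i).B₃) i z), ?_⟩
      have hx₁ : (F i).ρ₁₁ x - (F i).ρ₃₁ z = a := congrArg Prod.fst hx
      have hx₂ : (F i).ρ₂₂ y - (F i).ρ₃₂ z = b := congrArg Prod.snd hx
      rw [← hx₁, ← hx₂]
      refine Prod.ext ?_ ?_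
      · change DirectSum.lmap (fun i => (F i).ρ₁₁) _ - DirectSum.lmap (fun i => (F i).ρ₃₁) _ = _
        simp only [DirectSum.lmap_lof, map_sub]
      · change DirectSum.lmap (fun i => (F i).ρ₂₂) _ - DirectSum.lmap (fun i => (F i).ρ₃₂) _ = _
        simp only [DirectSum.lmap_lof, map_sub]
    rintro ⟨x, y⟩ -
    have hx : ((x, 0) : (KDiagram.directSum F).A₁ × (KDiagram.directSum F).A₂) ∈
        LinearMap.range (KDiagram.directSum F).differential := by
      induction x using DirectSum.induction_on with
      | zero => exact Submodule.zero_mem _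
      | of i a => exact (map_zero (DirectSum.lof k ι (fun i => (F i).A₂) i)) ▸ single i a 0
      | add a b ha hb =>
        have := Submodule.add_mem _ ha hb
        convert this using 1
        exact Prod.ext rfl (add_zero _).symm
    have hy : ((0, y) : (KDiagram.directSum F).A₁ × (KDiagram.directSum F).A₂) ∈
        LinearMap.range (KDiagram.directSum F).differential := by
      induction y using DirectSum.induction_on with
      | zero => exact Submodule.zero_mem _
      | of i a => exact (map_zero (DirectSum.lof k ι (fun i => (F i).A₁) i)) ▸ single i 0 a
      | add a b ha hb =>
        have := Submodule.add_mem _ ha hb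
        convert this using 1
        exact Prod.ext (add_zero _).symm rfl
    simpa using Submodule.add_mem _ hx hy

end DirectSum

/-- An isomorphism of `k`-diagrams with injective `ρ₁₁` and `ρ₂₂` is determined by its components
at `B₃`, `A₁`, `A₂`. -/
noncomputable def Iso.ofInjective {F G : KDiagram k} (hF₁ : Function.Injective F.ρ₁₁)
    (hF₂ : Function.Injective F.ρ₂₂) (hG₁ : Function.Injective G.ρ₁₁)
    (hG₂ : Function.Injective G.ρ₂₂) (b₃ : F.B₃ ≃ₗ[k] G.B₃) (a₁ : F.A₁ ≃ₗ[k] G.A₁)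
    (a₂ : F.A₂ ≃ₗ[k] G.A₂) (comm₃₁ : ∀ x, G.ρ₃₁ (b₃ x) = a₁ (F.ρ₃₁ x))
    (comm₃₂ : ∀ x, G.ρ₃₂ (b₃ x) = a₂ (F.ρ₃₂ x))
    (h₁ : ∀ x, x ∈ LinearMap.range F.ρ₁₁ ↔ a₁ x ∈ LinearMap.range G.ρ₁₁)
    (h₂ : ∀ x, x ∈ LinearMap.range F.ρ₂₂ ↔ a₂ x ∈ LinearMap.range G.ρ₂₂) : F.Iso G where
  b₁ := (LinearEquiv.ofInjective _ hF₁).trans ((a₁.ofSubmodules _ _ (by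
    ext y
    rw [Submodule.mem_map_equiv, h₁, a₁.apply_symm_apply])).trans
      (LinearEquiv.ofInjective _ hG₁).symm)
  b₂ := (LinearEquiv.ofInjective _ hF₂).trans ((a₂.ofSubmodules _ _ (by
    ext y
    rw [Submodule.mem_map_equiv, h₂, a₂.apply_symm_apply])).trans
      (LinearEquiv.ofInjective _ hG₂).symm)
  b₃ := b₃
  a₁ := a₁
  a₂ := a₂
  -- The component at B₁ is a₁ restricted to the images of ρ₁₁, so the square commutes by
  -- construction.
  comm₁₁ x := by
    have := fun y => congrArg Subtype.val ((LinearEquiv.ofInjective _ hG₁).apply_symm_apply y)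
    simp only [LinearEquiv.ofInjective_apply] at this
    simp [this]
  comm₂₂ x := by
    have := fun y => congrArg Subtype.val ((LinearEquiv.ofInjective _ hG₂).apply_symm_apply y)
    simp only [LinearEquiv.ofInjective_apply] at this
    simp [this]
  comm₃₁ := comm₃₁
  comm₃₂ := comm₃₂

/-! ### Classes of diagrams and the Eilenberg swindle. -/

/-- `F` is Fredholm and `x` is its class in the group of virtual `k`-diagrams. -/
def HasClass (F : KDiagram k) (x : VirtualDiagram k) : Prop :=
  ∃ hF : F.IsFredholm, Algebra.GrothendieckAddGroup.of (FredholmClass.of F hF) = x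

theorem HasClass.iso {F G : KDiagram k} {x : VirtualDiagram k} (h : F.HasClass x)
    (e : F.Iso G) : G.HasClass x := by
  obtain ⟨hF, rfl⟩ := h
  refine ⟨hF.of_iso e, congrArg _ (FredholmClass.of_eq_of_iff.2 ⟨e.symm⟩)⟩

theorem HasClass.sum {F G : KDiagram k} {x y : VirtualDiagram k} (hF : F.HasClass x)
    (hG : G.HasClass y) : (F.sum G).HasClass (x + y) := by
  obtain ⟨hF, rfl⟩ := hF
  obtain ⟨hG, rfl⟩ := hG
  exact ⟨hF.sum hG, by rw [← FredholmClass.of_add_of, map_add]⟩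

/-- The Eilenberg swindle: acyclic `k`-diagrams have class zero. -/
theorem IsAcyclic.hasClass {F : KDiagram k} (h : F.IsAcyclic) : F.HasClass 0 := by
  have hS : (KDiagram.directSum fun _ : ℕ => F).IsAcyclic := IsAcyclic.directSum fun _ => h
  have hS' : (KDiagram.directSum fun _ : Option ℕ => F).IsAcyclic := IsAcyclic.directSum fun _ => h
  obtain ⟨y, hy⟩ : ∃ y, (KDiagram.directSum fun _ : ℕ => F).HasClass y := ⟨_, hS.isFredholm, rfl⟩
  obtain ⟨x, hx⟩ : ∃ x, F.HasClass x := ⟨_, h.isFredholm, rfl⟩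
  -- One more copy of F does not change the countable sum, so x + y = y, and y cancels in the
  -- Grothendieck group.
  obtain ⟨e⟩ : Nonempty (ℕ ≃ Option ℕ) := ⟨(Denumerable.eqv (Option ℕ)).symm⟩
  have h₁ : (F.sum (KDiagram.directSum fun _ : ℕ => F)).HasClass y :=
    (hy.iso (Iso.directSumReindex e fun _ => F)).iso (Iso.directSumOption fun _ => F)
  obtain ⟨_, h₁⟩ := h₁
  obtain ⟨_, h₂⟩ := hx.sum hy
  have : x = 0 := by
    have := h₂.symm.trans h₁
    simpa using this
  exact this ▸ hx

theorem HasClass.directSum {ι : Type} [Fintype ι] {F : ι → KDiagram k}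
    {x : ι → VirtualDiagram k} (h : ∀ i, (F i).HasClass (x i)) :
    (directSum F).HasClass (∑ i, x i) := by
  suffices H : ∀ {F : ι → KDiagram k} {x : ι → VirtualDiagram k}, (∀ i, (F i).HasClass (x i)) →
      (KDiagram.directSum F).HasClass (∑ i, x i) from H h
  refine Fintype.induction_empty_option (P := fun ι _ => ∀ {F : ι → KDiagram k}
    {x : ι → VirtualDiagram k}, (∀ i, (F i).HasClass (x i)) →
      (KDiagram.directSum F).HasClass (∑ i, x i)) ?_ ?_ ?_ ι
  · intro α β _ e ih F x h
    let _ : Fintype α := Fintype.ofEquiv β e.symm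
    have := (ih (F := fun i => F (e i)) (x := fun i => x (e i)) fun i => h (e i)).iso
      (Iso.directSumReindex e fun i => F (e i))
    simp only [Equiv.apply_symm_apply] at this
    rwa [Fintype.sum_equiv e _ x fun _ => rfl] at this
  · intro F x h
    have hs : ∀ (M : PEmpty → Type u) [∀ i, AddCommMonoid (M i)],
        Subsingleton (DirectSum PEmpty M) := fun M _ => ⟨fun x y => DFinsupp.ext fun i => i.elim⟩
    have : Subsingleton (KDiagram.directSum F).B₁ := hs _
    have : Subsingleton (KDiagram.directSum F).B₂ := hs _
    have : Subsingleton (KDiagram.directSum F).B₃ := hs _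
    have : Subsingleton (KDiagram.directSum F).A₁ := hs _
    have : Subsingleton (KDiagram.directSum F).A₂ := hs _
    simpa using (isAcyclic_of_subsingleton (KDiagram.directSum F)).hasClass
  · intro α _ ih F x h
    rw [Fintype.sum_option]
    exact ((h none).sum (ih fun i => h (some i))).iso (Iso.directSumOption F).symm

theorem HasClass.directSum_split {ι : Type} {F : ι → KDiagram k} (p : ι → Prop)
    {x y : VirtualDiagram k} (h₁ : (KDiagram.directSum fun i : {i // p i} => F i).HasClass x)
    (h₂ : (KDiagram.directSum fun i : {i // ¬ p i} => F i).HasClass y) :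
    (KDiagram.directSum F).HasClass (x + y) :=
  (h₁.sum h₂).iso (Iso.directSumSplit F p).symm

end KDiagram

theorem VirtualDiagram.isClassOf_iff {k : Type u} [Field k] {c x y : VirtualDiagram k}
    {F G : KDiagram k} (hF : F.HasClass x) (hG : G.HasClass y) :
    c.IsClassOf F G ↔ c = x - y := by
  obtain ⟨hF, rfl⟩ := hF
  obtain ⟨hG, rfl⟩ := hG
  exact ⟨fun ⟨_, _, h⟩ => h, fun h => ⟨hF, hG, h⟩⟩

/-! ### Decomposition of integer matrices into permutation matrices. -/

/-- **König's theorem** for locally finite matrices: a matrix of natural numbers, all of whose row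
and column sums are `r ≥ 1`, contains the graph of a permutation. -/
theorem exists_perm_of_regular {N : ℤ → ℤ → ℕ} {r : ℕ} (hr : 0 < r) {R S : ℤ → Finset ℤ}
    (hR : ∀ x y, N x y ≠ 0 → y ∈ R x) (hS : ∀ x y, N x y ≠ 0 → x ∈ S y)
    (hrow : ∀ x, ∑ y ∈ R x, N x y = r) (hcol : ∀ y, ∑ x ∈ S y, N x y = r) :
    ∃ π : Equiv.Perm ℤ, ∀ x, N x (π x) ≠ 0 := by
  classical
  -- Stated for a general matrix so that it also applies to the transpose.
  have hall : ∀ (N : ℤ → ℤ → ℕ) (R S : ℤ → Finset ℤ), (∀ x y, N x y ≠ 0 → x ∈ S y) →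
      (∀ x, ∑ y ∈ R x, N x y = r) → (∀ y, ∑ x ∈ S y, N x y = r) →
      ∃ f : ℤ → ℤ, Function.Injective f ∧ ∀ x, N x (f x) ≠ 0 := by
    intro N R S hS hrow hcol
    obtain ⟨f, hf, hf'⟩ := (Finset.all_card_le_biUnion_card_iff_exists_injective
      (fun x => {y ∈ R x | N x y ≠ 0})).1 (by
        intro s
        set T := s.biUnion fun x => {y ∈ R x | N x y ≠ 0} with hT
        -- Hall's condition by double counting: the rows in s carry total mass r per row, all of it
        -- in the columns of T, which carry only r per column.
        have h₁ : s.card * r ≤ T.card * r := calc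
          s.card * r = ∑ x ∈ s, ∑ y ∈ R x, N x y := by simp [hrow]
          _ = ∑ x ∈ s, ∑ y ∈ R x with N x y ≠ 0, N x y := by simp only [Finset.sum_filter_ne_zero]
          _ ≤ ∑ x ∈ s, ∑ y ∈ T, N x y := Finset.sum_le_sum fun x hx =>
            Finset.sum_le_sum_of_subset (Finset.subset_biUnion_of_mem
              (fun x => {y ∈ R x | N x y ≠ 0}) hx)
          _ = ∑ y ∈ T, ∑ x ∈ s, N x y := Finset.sum_comm
          _ ≤ ∑ y ∈ T, ∑ x ∈ S y, N x y := Finset.sum_le_sum fun y _ => by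
            rw [← Finset.sum_filter_ne_zero]
            refine Finset.sum_le_sum_of_subset fun x hx => hS _ _ (Finset.mem_filter.1 hx).2
          _ = T.card * r := by simp [hcol]
        exact Nat.le_of_mul_le_mul_right h₁ hr)
    exact ⟨f, hf, fun x => (Finset.mem_filter.1 (hf' x)).2⟩
  obtain ⟨f, hf, hf'⟩ := hall N R S hS hrow hcol
  obtain ⟨g, hg, hg'⟩ := hall (fun y x => N x y) S R (fun y x => hR x y) hcol hrow
  -- The bijection obtained from f and g sends each x to f x or to a preimage of x under g, so its
  -- graph stays on nonzero entries.
  obtain ⟨h, hh, hh'⟩ := Function.Embedding.schroeder_bernstein_of_rel hf hg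
    (fun x y => N x y ≠ 0) hf' hg'
  exact ⟨Equiv.ofBijective h hh, hh'⟩

/-- A locally finite matrix of natural numbers, all of whose row and column sums are `r`, is a sum
of `r` permutation matrices. -/
theorem exists_perms_of_regular {r : ℕ} {R S : ℤ → Finset ℤ} :
    ∀ {N : ℤ → ℤ → ℕ}, (∀ x y, N x y ≠ 0 → y ∈ R x) → (∀ x y, N x y ≠ 0 → x ∈ S y) →
    (∀ x, ∑ y ∈ R x, N x y = r) → (∀ y, ∑ x ∈ S y, N x y = r) →
    ∃ π : Fin r → Equiv.Perm ℤ, ∀ x y, N x y = ∑ i, if y = π i x then 1 else 0 := by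
  induction r with
  | zero =>
    intro N hR hS hrow hcol
    refine ⟨Fin.elim0, fun x y => ?_⟩
    by_contra h
    rw [Finset.univ_eq_empty, Finset.sum_empty] at h
    exact h (Finset.sum_eq_zero_iff.1 (hrow x) y (hR x y h))
  | succ r ih =>
    intro N hR hS hrow hcol
    obtain ⟨π, hπ⟩ := exists_perm_of_regular r.succ_pos hR hS hrow hcol
    -- The natural subtraction is exact, as N is at least 1 on the graph of π; removing the graph
    -- lowers every row and column sum by one.
    set N' : ℤ → ℤ → ℕ := fun x y => N x y - if y = π x then 1 else 0 with hN'
    have hle : ∀ x y, N x y = N' x y + if y = π x then 1 else 0 := by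
      intro x y
      have : (if y = π x then 1 else 0) ≤ N x y := by
        split_ifs with h
        · exact h ▸ Nat.one_le_iff_ne_zero.2 (hπ x)
        · exact Nat.zero_le _
      simp only [hN']
      omega
    have hne : ∀ x y, N' x y ≠ 0 → N x y ≠ 0 := fun x y h => by
      have := hle x y
      omega
    obtain ⟨σ, hσ⟩ := ih (N := N') (fun x y h => hR x y (hne x y h))
      (fun x y h => hS x y (hne x y h)) (fun x => by
        have h := hrow x
        simp only [hle, Finset.sum_add_distrib, Finset.sum_ite_eq', if_pos (hR _ _ (hπ x))] at h
        omega) (fun y => by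
        have h := hcol y
        have hy : ∀ x, y = π x ↔ x = π.symm y := fun x => by
          rw [Equiv.eq_symm_apply, eq_comm]
        have hm : π.symm y ∈ S y := hS _ _ (by simpa using hπ (π.symm y))
        simp only [hle, Finset.sum_add_distrib, hy, Finset.sum_ite_eq', if_pos hm] at h
        omega)
    refine ⟨Fin.cons π σ, fun x y => ?_⟩
    rw [Fin.sum_univ_succ, hle, hσ, add_comm]
    simp

theorem isPerfectMatching_of_perm {W : (Fin 2 → ℤ) → ℤ} {π : Equiv.Perm ℤ} {m M : ℤ}
    (hW : ∀ a, W a = if a 1 = π (a 0) then 1 else 0)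
    (hπ : ∀ x, m < x + π x ∧ x + π x < M) : IsPerfectMatching W := by
  have hdeg : ∀ a : Fin 2 → ℤ, vecDeg a = a 0 + a 1 := fun a => Fin.sum_univ_two a
  refine ⟨⟨m, fun a ha => ?_⟩, ⟨M, fun a ha => ?_⟩, π, hW⟩ <;>
  · rw [hW, if_neg]
    intro h
    rw [hdeg, h] at ha
    have := hπ (a 0)
    omega

/-- A bounded integer matrix on `ℤ × ℤ` that is supported in a strip around the antidiagonal and
has all row and column sums equal to `1` is a difference of sums of perfect matchings. -/
theorem exists_isMatchingDecomposition {W : (Fin 2 → ℤ) → ℤ} {m M B : ℤ}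
    (hband : ∀ a, W a ≠ 0 → m < a 0 + a 1 ∧ a 0 + a 1 < M) (hB : ∀ a, |W a| ≤ B)
    (hrow : ∀ x, ∑ y ∈ Finset.Ioo (m - x) (M - x), W ![x, y] = 1)
    (hcol : ∀ y, ∑ x ∈ Finset.Ioo (m - y) (M - y), W ![x, y] = 1) :
    ∃ (s : ℕ) (P : Fin (s + 1) → (Fin 2 → ℤ) → ℤ) (Q : Fin s → (Fin 2 → ℤ) → ℤ),
      IsMatchingDecomposition W P Q := by
  classical
  set I := Finset.Ioo m M with hI
  set D := I ×ˢ Finset.range B.toNat with hD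
  have hB0 : 0 ≤ B := (abs_nonneg _).trans (hB 0)
  set s := D.card with hs
  have e : Fin s ≃ D := D.equivFin.symm
  -- the antidiagonals of the strip, each repeated `B` times
  set Q : Fin s → (Fin 2 → ℤ) → ℤ := fun i a => if a 1 = (e i).1.1 - a 0 then 1 else 0 with hQ
  have hsumQ : ∀ x y, ∑ i, Q i ![x, y] = if x + y ∈ I then B else 0 := by
    intro x y
    have h₁ : ∑ i, Q i ![x, y] = ∑ p ∈ D, if y = p.1 - x then (1 : ℤ) else 0 := by
      rw [← Finset.sum_coe_sort D, ← Equiv.sum_comp e]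
      simp [hQ]
    have h₂ : ∀ p : ℤ, y = p - x ↔ p = x + y := fun p => by omega
    rw [h₁, hD, Finset.sum_product]
    simp only [h₂, Finset.sum_const, Finset.card_range, nsmul_eq_mul, Int.toNat_of_nonneg hB0,
      mul_ite, mul_one, mul_zero, Finset.sum_ite_eq']
  -- Inside the strip B is added to W ≥ -B; outside it both terms vanish.
  have hN0 : ∀ x y, 0 ≤ W ![x, y] + ∑ i, Q i ![x, y] := by
    intro x y
    rw [hsumQ]
    split_ifs with h
    · have := neg_abs_le (W ![x, y])
      have := hB ![x, y]
      omega
    · by_cases hW : W ![x, y] = 0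
      · simp [hW]
      · exact absurd (Finset.mem_Ioo.2 (hband _ hW)) h
  set N : ℤ → ℤ → ℕ := fun x y => (W ![x, y] + ∑ i, Q i ![x, y]).toNat with hN
  have hNc : ∀ x y, (N x y : ℤ) = W ![x, y] + ∑ i, Q i ![x, y] := fun x y =>
    Int.toNat_of_nonneg (hN0 x y)
  have hNband : ∀ x y, N x y ≠ 0 → x + y ∈ I := by
    intro x y h
    by_contra hI'
    have hW : W ![x, y] = 0 := by
      by_contra hW
      exact hI' (Finset.mem_Ioo.2 (hband _ hW))
    have := hNc x y
    rw [hsumQ, if_neg hI', hW] at this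
    omega
  have hmem : ∀ x y, x + y ∈ I → y ∈ Finset.Ioo (m - x) (M - x) ∧
      x ∈ Finset.Ioo (m - y) (M - y) := by
    intro x y h
    rw [hI, Finset.mem_Ioo] at h
    simp only [Finset.mem_Ioo]
    omega
  -- Each row or column meets the strip in as many cells as there are antidiagonals. The
  -- antidiagonals therefore add s to its sum, and W adds 1, whence the value s + 1 below.
  have hconst : ∀ x : ℤ, ((Finset.Ioo (m - x) (M - x)).card : ℤ) * B = s := by
    intro x
    rw [hs, hD, Finset.card_product, Finset.card_range, hI, Int.card_Ioo, Int.card_Ioo]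
    push_cast
    rw [Int.toNat_of_nonneg hB0]
    congr 3
    ring
  obtain ⟨π, hπ⟩ := exists_perms_of_regular (r := s + 1) (N := N)
    (R := fun x => Finset.Ioo (m - x) (M - x)) (S := fun y => Finset.Ioo (m - y) (M - y))
    (fun x y h => (hmem x y (hNband x y h)).1) (fun x y h => (hmem x y (hNband x y h)).2)
    (fun x => by
      zify
      simp only [hNc, Finset.sum_add_distrib, hrow, hsumQ]
      have : ∀ y ∈ Finset.Ioo (m - x) (M - x), (if x + y ∈ I then B else 0) = B := fun y hy => by
        rw [Finset.mem_Ioo] at hy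
        rw [if_pos]
        rw [hI, Finset.mem_Ioo]
        omega
      rw [Finset.sum_congr rfl this, Finset.sum_const, nsmul_eq_mul, hconst, add_comm])
    (fun y => by
      zify
      simp only [hNc, Finset.sum_add_distrib, hcol, hsumQ]
      have : ∀ x ∈ Finset.Ioo (m - y) (M - y), (if x + y ∈ I then B else 0) = B := fun x hx => by
        rw [Finset.mem_Ioo] at hx
        rw [if_pos]
        rw [hI, Finset.mem_Ioo]
        omega
      rw [Finset.sum_congr rfl this, Finset.sum_const, nsmul_eq_mul, hconst, add_comm])
  refine ⟨s, fun i a => if a 1 = π i (a 0) then 1 else 0, Q, fun i => ?_, fun i => ?_, fun a => ?_⟩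
  · refine isPerfectMatching_of_perm (m := m) (M := M) (π := π i) (fun a => rfl) fun x => ?_
    refine Finset.mem_Ioo.1 (hNband x (π i x) ?_)
    rw [hπ]
    refine fun h => ?_
    have := Finset.sum_eq_zero_iff.1 h i (Finset.mem_univ i)
    simp at this
  · refine isPerfectMatching_of_perm (m := m) (M := M)
      (π := Equiv.subLeft (e i).1.1) (fun a => rfl) fun x => ?_
    have := Finset.mem_Ioo.1 (Finset.mem_product.1 (e i).2).1
    rw [Equiv.subLeft_apply]
    omega
  · have ha : a = ![a 0, a 1] := by
      ext i
      fin_cases i <;> rfl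
    have h₁ := hNc (a 0) (a 1)
    rw [hπ, ← ha] at h₁
    push_cast at h₁
    rw [h₁]
    ring

/-! ### Betti numbers of classes. -/

namespace VirtualDiagram

variable {k : Type u} [Field k]

theorem _root_.KDiagram.HasClass.b0_eq {F : KDiagram k} {x : VirtualDiagram k}
    (h : F.HasClass x) : x.b0 = Module.finrank k F.H0 := by
  obtain ⟨hF, rfl⟩ := h
  exact DFunLike.congr_fun
    (Algebra.GrothendieckAddGroup.lift.symm_apply_apply FredholmClass.betti0) _

theorem _root_.KDiagram.HasClass.b1_eq {F : KDiagram k} {x : VirtualDiagram k}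
    (h : F.HasClass x) : x.b1 = Module.finrank k F.H1 := by
  obtain ⟨hF, rfl⟩ := h
  exact DFunLike.congr_fun
    (Algebra.GrothendieckAddGroup.lift.symm_apply_apply FredholmClass.betti1) _

theorem b0_zsmul_add_zsmul (m n : ℤ) (x y : VirtualDiagram k) :
    (m • x + n • y).b0 = m * x.b0 + n * y.b0 := by
  simp only [b0, map_add, map_zsmul, smul_eq_mul]

theorem b1_zsmul_add_zsmul (m n : ℤ) (x y : VirtualDiagram k) :
    (m • x + n • y).b1 = m * x.b1 + n * y.b1 := by
  simp only [b1, map_add, map_zsmul, smul_eq_mul]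

end VirtualDiagram

/-! ### Cohomology and classes of indicator diagrams. -/

section Indicator

variable {k : Type u} [Field k]

open KDiagram

/-- The `k`-diagram `S → k ← k → k ← T` for subspaces `S` and `T` of `k`. -/
def subspaceDiagram (S T : Submodule k k) : KDiagram k where
  B₁ := S
  B₂ := T
  B₃ := k
  A₁ := k
  A₂ := k
  ρ₁₁ := S.subtype
  ρ₂₂ := T.subtype
  ρ₃₁ := LinearMap.id
  ρ₃₂ := LinearMap.id

theorem indicatorDiagram_eq_subspaceDiagram (d a : Fin 2 → ℤ) :
    indicatorDiagram k d a =
      subspaceDiagram (if a 0 ≤ d 0 then ⊤ else ⊥) (if a 1 ≤ d 1 then ⊤ else ⊥) := rfl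

/-- Rank–nullity for a map from S × T × k to k × k: the Euler characteristic is dim S + dim T + 1 -
2. -/
theorem subspaceDiagram_finrank (S T : Submodule k k) :
    Module.finrank k (subspaceDiagram S T).H0 + 1 =
      Module.finrank k (subspaceDiagram S T).H1 + (Module.finrank k S + Module.finrank k T) := by
  have : Module.Finite k (S × T × k) := inferInstance
  let D : (S × T × k) →ₗ[k] (k × k) := (subspaceDiagram S T).differential
  have h₁ : Module.finrank k (LinearMap.range D) + Module.finrank k (LinearMap.ker D) =
      Module.finrank k (S × T × k) := D.finrank_range_add_finrank_ker
  have h₂ : Module.finrank k ((k × k) ⧸ LinearMap.range D) +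
      Module.finrank k (LinearMap.range D) = Module.finrank k (k × k) :=
    Submodule.finrank_quotient_add_finrank _
  rw [Module.finrank_prod, Module.finrank_prod, Module.finrank_self] at h₁
  rw [Module.finrank_prod, Module.finrank_self] at h₂
  change Module.finrank k (LinearMap.ker D) + 1 =
    Module.finrank k ((k × k) ⧸ LinearMap.range D) + _
  omega

theorem subspaceDiagram_isFredholm (S T : Submodule k k) : (subspaceDiagram S T).IsFredholm := by
  let D : (S × T × k) →ₗ[k] (k × k) := (subspaceDiagram S T).differential
  constructor
  · change Module.Finite k (LinearMap.ker D)
    infer_instance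
  · change Module.Finite k ((k × k) ⧸ LinearMap.range D)
    infer_instance

theorem subspaceDiagram_top_bot_isAcyclic : (subspaceDiagram (⊤ : Submodule k k) ⊥).IsAcyclic := by
  constructor
  · rw [← LinearMap.ker_eq_bot, LinearMap.ker_eq_bot']
    rintro ⟨⟨x, hx⟩, ⟨y, hy⟩, (z : k)⟩ h
    have h₁ : x - z = 0 := congrArg Prod.fst h
    have h₂ : y - z = 0 := congrArg Prod.snd h
    rw [Submodule.mem_bot] at hy
    have hz : z = 0 := by rw [hy] at h₂; simpa using h₂
    have hx : x = 0 := by rw [hz] at h₁; simpa using h₁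
    exact Prod.ext (Subtype.ext hx) (Prod.ext (Subtype.ext hy) hz)
  · rintro ⟨(x : k), (y : k)⟩
    refine ⟨(⟨x - y, Submodule.mem_top⟩, ⟨0, Submodule.zero_mem _⟩, -y), Prod.ext ?_ ?_⟩
    · change x - y - -y = x
      ring
    · change (0 : k) - -y = y
      ring

theorem subspaceDiagram_bot_top_isAcyclic : (subspaceDiagram (⊥ : Submodule k k) ⊤).IsAcyclic := by
  constructor
  · rw [← LinearMap.ker_eq_bot, LinearMap.ker_eq_bot']
    rintro ⟨⟨x, hx⟩, ⟨y, hy⟩, (z : k)⟩ h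
    have h₁ : x - z = 0 := congrArg Prod.fst h
    have h₂ : y - z = 0 := congrArg Prod.snd h
    rw [Submodule.mem_bot] at hx
    have hz : z = 0 := by rw [hx] at h₁; simpa using h₁
    have hy : y = 0 := by rw [hz] at h₂; simpa using h₂
    exact Prod.ext (Subtype.ext hx) (Prod.ext (Subtype.ext hy) hz)
  · rintro ⟨(x : k), (y : k)⟩
    refine ⟨(⟨0, Submodule.zero_mem _⟩, ⟨y - x, Submodule.mem_top⟩, -x), Prod.ext ?_ ?_⟩
    · change (0 : k) - -x = x
      ring
    · change y - x - -x = y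
      ring

theorem subspaceDiagram_top_top_finrank_H1 :
    Module.finrank k (subspaceDiagram (⊤ : Submodule k k) ⊤).H1 = 0 := by
  have : Subsingleton (subspaceDiagram (⊤ : Submodule k k) ⊤).H1 := by
    refine Submodule.Quotient.subsingleton_iff.2 (LinearMap.range_eq_top.2 ?_)
    rintro ⟨(x : k), (y : k)⟩
    refine ⟨(⟨x, Submodule.mem_top⟩, ⟨y, Submodule.mem_top⟩, 0), Prod.ext ?_ ?_⟩
    · exact sub_zero x
    · exact sub_zero y
  exact Module.finrank_zero_of_subsingleton

theorem subspaceDiagram_bot_bot_finrank_H0 :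
    Module.finrank k (subspaceDiagram (⊥ : Submodule k k) ⊥).H0 = 0 := by
  have : Subsingleton (subspaceDiagram (⊥ : Submodule k k) ⊥).H0 := by
    refine Submodule.subsingleton_iff_eq_bot.2 (LinearMap.ker_eq_bot'.2 ?_)
    rintro ⟨⟨x, hx⟩, ⟨y, hy⟩, (z : k)⟩ h
    have h₁ : x - z = 0 := congrArg Prod.fst h
    rw [Submodule.mem_bot] at hx hy
    have hz : z = 0 := by rw [hx] at h₁; simpa using h₁
    exact Prod.ext (Subtype.ext hx) (Prod.ext (Subtype.ext hy) hz)
  exact Module.finrank_zero_of_subsingleton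

variable (k) in
/-- The class of the indicator diagrams with `dim H⁰ = 1` and `H¹ = 0`, and the class of those with
`H⁰ = 0` and `dim H¹ = 1`. -/
theorem exists_indicatorDiagram_classes : ∃ α β : VirtualDiagram k,
    (∀ a ≤ 0, (indicatorDiagram k 0 a).HasClass α) ∧
    (∀ a : Fin 2 → ℤ, 0 < a 0 ∧ 0 < a 1 → (indicatorDiagram k 0 a).HasClass β) ∧
    α.b0 = 1 ∧ α.b1 = 0 ∧ β.b0 = 0 ∧ β.b1 = 1 := by
  obtain ⟨α, hα⟩ : ∃ α, (subspaceDiagram (⊤ : Submodule k k) ⊤).HasClass α :=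
    ⟨_, subspaceDiagram_isFredholm _ _, rfl⟩
  obtain ⟨β, hβ⟩ : ∃ β, (subspaceDiagram (⊥ : Submodule k k) ⊥).HasClass β :=
    ⟨_, subspaceDiagram_isFredholm _ _, rfl⟩
  -- In each case one cohomology group visibly vanishes and the Euler characteristic determines the
  -- other.
  have ht := subspaceDiagram_finrank (⊤ : Submodule k k) ⊤
  have hb := subspaceDiagram_finrank (⊥ : Submodule k k) ⊥
  rw [subspaceDiagram_top_top_finrank_H1, finrank_top, Module.finrank_self] at ht
  rw [subspaceDiagram_bot_bot_finrank_H0, finrank_bot] at hb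
  refine ⟨α, β, fun a ha => ?_, fun a ha => ?_, ?_, ?_, ?_, ?_⟩
  · rw [indicatorDiagram_eq_subspaceDiagram, if_pos (ha 0), if_pos (ha 1)]
    exact hα
  · have h0 : ¬ a 0 ≤ (0 : Fin 2 → ℤ) 0 := ha.1.not_ge
    have h1 : ¬ a 1 ≤ (0 : Fin 2 → ℤ) 1 := ha.2.not_ge
    rw [indicatorDiagram_eq_subspaceDiagram, if_neg h0, if_neg h1]
    exact hβ
  · rw [hα.b0_eq]
    exact_mod_cast (by omega : Module.finrank k (subspaceDiagram (⊤ : Submodule k k) ⊤).H0 = 1)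
  · rw [hα.b1_eq, subspaceDiagram_top_top_finrank_H1, Nat.cast_zero]
  · rw [hβ.b0_eq, subspaceDiagram_bot_bot_finrank_H0, Nat.cast_zero]
  · rw [hβ.b1_eq]
    exact_mod_cast (by omega : Module.finrank k (subspaceDiagram (⊥ : Submodule k k) ⊥).H1 = 1)

/-- Exactly one of B₁ and B₂ is k here, and the differential becomes an invertible triangular map of
planes. -/
theorem indicatorDiagram_isAcyclic {a : Fin 2 → ℤ} (h₁ : ¬ a ≤ 0) (h₂ : ¬ (0 < a 0 ∧ 0 < a 1)) :
    (indicatorDiagram k 0 a).IsAcyclic := by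
  rw [indicatorDiagram_eq_subspaceDiagram]
  simp only [Pi.zero_apply]
  rw [Pi.le_def, Fin.forall_fin_two] at h₁
  simp only [Pi.zero_apply] at h₁
  by_cases h0 : a 0 ≤ 0
  · rw [if_pos h0, if_neg fun h => h₁ ⟨h0, h⟩]
    exact subspaceDiagram_top_bot_isAcyclic
  · rw [if_neg h0, if_pos (by omega)]
    exact subspaceDiagram_bot_top_isAcyclic

end Indicator

/-! ### Counting points with multiplicity. -/

section MultiSupport

theorem finsum_mem_eq_card_multiSupport {W : (Fin 2 → ℤ) → ℤ} (hW : ∀ a, 0 ≤ W a)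
    {A : Set (Fin 2 → ℤ)} (hA : (A ∩ Function.support W).Finite) :
    Finite {x : MultiSupport W // x.1.1 ∈ A} ∧
      (Nat.card {x : MultiSupport W // x.1.1 ∈ A} : ℤ) = ∑ᶠ (a) (_ : a ∈ A), W a := by
  classical
  -- Copies are numbered from 1 in `MultiSupport` and from 0 in `Fin`, hence the shift by one.
  have e : {x : MultiSupport W // x.1.1 ∈ A} ≃ Σ a : hA.toFinset, Fin (W a.1).toNat :=
    { toFun := fun x => ⟨⟨x.1.1.1, by
          have := x.1.2
          rw [Set.Finite.mem_toFinset]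
          exact ⟨x.2, fun h => by rw [h] at this; omega⟩⟩,
        ⟨x.1.1.2 - 1, by have := x.1.2; simp only; omega⟩⟩
      invFun := fun y => ⟨⟨(y.1.1, y.2.1 + 1), by
          have := y.2.2
          simp only
          omega⟩, ((Set.Finite.mem_toFinset _).1 y.1.2).1⟩
      left_inv := fun x => Subtype.ext (Subtype.ext (Prod.ext rfl (by
        have := x.1.2
        simp only
        omega)))
      right_inv := fun y => rfl }
  refine ⟨Finite.of_equiv _ e.symm, ?_⟩
  rw [Nat.card_congr e, Nat.card_eq_fintype_card, Fintype.card_sigma,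
    finsum_mem_eq_sum W hA, ← Finset.sum_coe_sort hA.toFinset W]
  push_cast
  refine Finset.sum_congr rfl fun a _ => ?_
  rw [Fintype.card_fin, Int.toNat_of_nonneg (hW _)]

theorem finsum_mem_sum_sub_sum {α ι κ : Type*} [Fintype ι] [Fintype κ] {A : Set α} {W : α → ℤ}
    {P : ι → α → ℤ} {Q : κ → α → ℤ} (hP : ∀ i, (A ∩ Function.support (P i)).Finite)
    (hQ : ∀ i, (A ∩ Function.support (Q i)).Finite)
    (hW : ∀ a, W a = ∑ i, P i a - ∑ i, Q i a) :
    ∑ᶠ (a) (_ : a ∈ A), W a =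
      ∑ i, ∑ᶠ (a) (_ : a ∈ A), P i a - ∑ i, ∑ᶠ (a) (_ : a ∈ A), Q i a := by
  classical
  -- A common finite set T carries all the sums; the support of W may be smaller by cancellation.
  have hfin := (Set.finite_iUnion hP).union (Set.finite_iUnion hQ)
  set T := hfin.toFinset with hT
  have hTA : (T : Set α) ⊆ A := by
    rw [hT, Set.Finite.coe_toFinset, Set.union_subset_iff, Set.iUnion_subset_iff,
      Set.iUnion_subset_iff]
    exact ⟨fun i => Set.inter_subset_left, fun i => Set.inter_subset_left⟩
  have hPT : ∀ i, A ∩ Function.support (P i) ⊆ T := fun i => by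
    rw [hT, Set.Finite.coe_toFinset]
    exact (Set.subset_iUnion (fun i => A ∩ Function.support (P i)) i).trans Set.subset_union_left
  have hQT : ∀ i, A ∩ Function.support (Q i) ⊆ T := fun i => by
    rw [hT, Set.Finite.coe_toFinset]
    exact (Set.subset_iUnion (fun i => A ∩ Function.support (Q i)) i).trans Set.subset_union_right
  have hWT : A ∩ Function.support W ⊆ T := by
    rintro a ⟨ha, haW⟩
    by_contra h
    refine haW ?_
    rw [hW, Finset.sum_eq_zero, Finset.sum_eq_zero, sub_zero]
    · intro i _
      by_contra h'
      exact h (hQT i ⟨ha, h'⟩)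
    · intro i _
      by_contra h'
      exact h (hPT i ⟨ha, h'⟩)
  rw [finsum_mem_eq_sum_of_subset _ hWT hTA]
  simp only [fun i => finsum_mem_eq_sum_of_subset _ (hPT i) hTA,
    fun i => finsum_mem_eq_sum_of_subset _ (hQT i) hTA, hW, Finset.sum_sub_distrib]
  rw [Finset.sum_comm, Finset.sum_comm (s := T)]

end MultiSupport

theorem vecDeg_two (a : Fin 2 → ℤ) : vecDeg a = a 0 + a 1 := Fin.sum_univ_two a

/-- The pairs of positive integers. -/
def positiveQuadrant : Set (Fin 2 → ℤ) := {a | 0 < a 0 ∧ 0 < a 1}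

/-- If both coordinates are at most 0 and their sum exceeds m, each coordinate exceeds m. -/
theorem IsInitiallyZero.finite {W : (Fin 2 → ℤ) → ℤ} (h : IsInitiallyZero W) :
    (Set.Iic (0 : Fin 2 → ℤ) ∩ Function.support W).Finite := by
  obtain ⟨m, hm⟩ := h
  refine (Set.finite_Icc (fun _ => m) (0 : Fin 2 → ℤ)).subset ?_
  rintro a ⟨ha, haW⟩
  have ha' : a 0 ≤ 0 ∧ a 1 ≤ 0 := ⟨ha 0, ha 1⟩
  have : ¬ vecDeg a ≤ m := fun h => haW (hm a h)
  rw [vecDeg_two] at this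
  refine ⟨?_, ha⟩
  rw [Pi.le_def, Fin.forall_fin_two]
  omega

theorem IsEventuallyZero.finite {W : (Fin 2 → ℤ) → ℤ} (h : IsEventuallyZero W) :
    (positiveQuadrant ∩ Function.support W).Finite := by
  obtain ⟨m, hm⟩ := h
  refine (Set.finite_Icc (0 : Fin 2 → ℤ) (fun _ => m)).subset ?_
  rintro a ⟨ha, haW⟩
  have ha' : 0 < a 0 ∧ 0 < a 1 := ha
  have : ¬ m ≤ vecDeg a := fun h => haW (hm a h)
  rw [vecDeg_two] at this
  rw [Set.mem_Icc, Pi.le_def, Pi.le_def, Fin.forall_fin_two, Fin.forall_fin_two]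
  simp only [Pi.zero_apply]
  omega

/-! ### Classes of indicator sums and of matching diagrams. -/

section Classes

variable {k : Type u} [Field k] {α β : VirtualDiagram k}

theorem hasClass_indicatorSum (hα : ∀ a ≤ 0, (indicatorDiagram k 0 a).HasClass α)
    (hβ : ∀ a ∈ positiveQuadrant, (indicatorDiagram k 0 a).HasClass β)
    {W : (Fin 2 → ℤ) → ℤ} (hW : ∀ a, 0 ≤ W a) (h₁ : IsInitiallyZero W) (h₂ : IsEventuallyZero W) :
    (indicatorSum k W 0).HasClass
      ((∑ᶠ (a) (_ : a ∈ Set.Iic 0), W a) • α +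
        (∑ᶠ (a) (_ : a ∈ positiveQuadrant), W a) • β) := by
  obtain ⟨f₁, c₁⟩ := finsum_mem_eq_card_multiSupport hW h₁.finite
  obtain ⟨f₂, c₂⟩ := finsum_mem_eq_card_multiSupport hW h₂.finite
  refine KDiagram.HasClass.directSum_split (fun x => x.1.1 ∈ Set.Iic 0) ?_ ?_
  · have := Fintype.ofFinite {x : MultiSupport W // x.1.1 ∈ Set.Iic 0}
    rw [← c₁, Nat.card_eq_fintype_card, natCast_zsmul, ← Finset.card_univ, ← Finset.sum_const]
    exact KDiagram.HasClass.directSum fun x => hα _ x.2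
  · have hpos : ∀ x : MultiSupport W, x.1.1 ∈ positiveQuadrant → ¬ x.1.1 ∈ Set.Iic 0 :=
      fun x hx h => hx.1.not_ge (h 0)
    have e : {x : {x : MultiSupport W // ¬ x.1.1 ∈ Set.Iic 0} // x.1.1.1 ∈ positiveQuadrant} ≃
        {x : MultiSupport W // x.1.1 ∈ positiveQuadrant} :=
      Equiv.subtypeSubtypeEquivSubtype (p := fun x : MultiSupport W => ¬ x.1.1 ∈ Set.Iic 0)
        (q := fun x : MultiSupport W => x.1.1 ∈ positiveQuadrant) (hpos _)
    have := Finite.of_equiv _ e.symm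
    have := Fintype.ofFinite
      {x : {x : MultiSupport W // ¬ x.1.1 ∈ Set.Iic 0} // x.1.1.1 ∈ positiveQuadrant}
    -- The added 0 is the class of the summands lying neither in a ≤ 0 nor in the positive quadrant;
    -- there may be infinitely many, but they are acyclic.
    rw [← add_zero ((_ : ℤ) • β), ← c₂, ← Nat.card_congr e, Nat.card_eq_fintype_card,
      natCast_zsmul, ← Finset.card_univ, ← Finset.sum_const]
    refine KDiagram.HasClass.directSum_split (fun x => x.1.1.1 ∈ positiveQuadrant) ?_ ?_
    · exact KDiagram.HasClass.directSum fun x => hβ _ x.2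
    · exact (KDiagram.IsAcyclic.directSum fun x =>
        indicatorDiagram_isAcyclic x.1.2 x.2).hasClass

/-! ### Matching diagrams as indicator sums. -/

section MatchingDiagram

open scoped DirectSum

variable {S : Type} [DecidableEq S]

/-- The isomorphism `k^{⊕ℤ} ≃ k^{⊕S}` given by a bijection `S ≃ ℤ`. -/
noncomputable def finsuppIntEquivDirectSum (k : Type u) [Field k] (e : S ≃ ℤ) :
    (ℤ →₀ k) ≃ₗ[k] ⨁ _ : S, k :=
  (Finsupp.domLCongr e.symm).trans (finsuppLEquivDirectSum k k S)

theorem finsuppIntEquivDirectSum_apply (e : S ≃ ℤ) (x : ℤ →₀ k) (i : S) :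
    finsuppIntEquivDirectSum k e x i = x (e i) := by
  rw [finsuppIntEquivDirectSum, LinearEquiv.trans_apply, finsuppLEquivDirectSum_apply,
    Finsupp.domLCongr_apply, Finsupp.domCongr_apply, Finsupp.equivMapDomain_apply, Equiv.symm_symm]

theorem finsuppIntEquivDirectSum_mapDomain (e : S ≃ ℤ) {p : S → ℤ} (hp : ∀ i, e i = p i)
    (x : S →₀ k) :
    DirectSum.lmap (fun _ => LinearMap.id (R := k) (M := k)) (finsuppLEquivDirectSum k k S x) =
      finsuppIntEquivDirectSum k e (Finsupp.lmapDomain k k p x) := by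
  obtain rfl : ⇑e = p := funext hp
  refine DFinsupp.ext fun i => ?_
  rw [DirectSum.lmap_apply, LinearMap.id_apply, finsuppIntEquivDirectSum_apply,
    finsuppLEquivDirectSum_apply, Finsupp.lmapDomain_apply, Finsupp.mapDomain_apply e.injective]

/-- Both sides say that the coordinates of x beyond d vanish. This is the range condition that
`KDiagram.Iso.ofInjective` requires. -/
theorem mem_range_lmapDomain_Iic_iff (e : S ≃ ℤ) {p : S → ℤ} (hp : ∀ i, e i = p i) (d : ℤ)
    (x : ℤ →₀ k) :
    x ∈ LinearMap.range (Finsupp.lmapDomain k k (Subtype.val : Set.Iic d → ℤ)) ↔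
      finsuppIntEquivDirectSum k e x ∈ LinearMap.range (DirectSum.lmap fun i : S =>
        (if p i ≤ d then ⊤ else ⊥ : Submodule k k).subtype) := by
  obtain rfl : ⇑e = p := funext hp
  rw [DirectSum.range_lmap, Submodule.mem_comap, Submodule.mem_pi]
  refine (Finsupp.mem_range_mapDomain_iff _ Subtype.val_injective x).trans ?_
  rw [← e.forall_congr_right]
  refine forall_congr' fun i => ?_
  rw [Subtype.range_coe, Submodule.range_subtype, DirectSum.coeFnLinearMap_apply,
    finsuppIntEquivDirectSum_apply, Set.mem_Iic]
  by_cases h : e i ≤ d <;> simp [h]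

end MatchingDiagram

open Classical in
/-- The diagram of a matching is the direct sum of the indicator diagrams of its points. -/
noncomputable def matchingDiagramIso {W : (Fin 2 → ℤ) → ℤ} (d : Fin 2 → ℤ)
    (e : Fin 2 → MultiSupport W ≃ ℤ) (h : ∀ j x, e j x = x.1.1 j) :
    (matchingDiagram k W d).Iso (indicatorSum k W d) :=
  KDiagram.Iso.ofInjective
    (F := matchingDiagram k W d) (G := indicatorSum k W d)
    (Finsupp.mapDomain_injective Subtype.val_injective)
    (Finsupp.mapDomain_injective Subtype.val_injective)
    ((DirectSum.lmap_injective _).2 fun _ => Subtype.val_injective)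
    ((DirectSum.lmap_injective _).2 fun _ => Subtype.val_injective)
    (finsuppLEquivDirectSum k k (MultiSupport W))
    (finsuppIntEquivDirectSum k (e 0)) (finsuppIntEquivDirectSum k (e 1))
    (finsuppIntEquivDirectSum_mapDomain (e 0) (h 0))
    (finsuppIntEquivDirectSum_mapDomain (e 1) (h 1))
    (mem_range_lmapDomain_Iic_iff (e 0) (h 0) (d 0))
    (mem_range_lmapDomain_Iic_iff (e 1) (h 1) (d 1))

theorem IsPerfectMatching.nonneg {W : (Fin 2 → ℤ) → ℤ} (hW : IsPerfectMatching W)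
    (a : Fin 2 → ℤ) : 0 ≤ W a := by
  obtain ⟨-, -, π, hπ⟩ := hW
  rw [hπ]
  split_ifs <;> simp

/-- Every point of a matching has multiplicity one, and the graph of a bijection projects
bijectively to both factors. -/
theorem IsPerfectMatching.exists_equiv {W : (Fin 2 → ℤ) → ℤ} (hW : IsPerfectMatching W) :
    ∃ e : Fin 2 → MultiSupport W ≃ ℤ, ∀ j x, e j x = x.1.1 j := by
  obtain ⟨-, -, π, hπ⟩ := hW
  have hx : ∀ x : MultiSupport W, x.1.1 1 = π (x.1.1 0) ∧ x.1.2 = 1 := by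
    intro x
    have h := x.2
    rw [hπ] at h
    split_ifs at h with h'
    · exact ⟨h', by omega⟩
    · omega
  let e : MultiSupport W ≃ ℤ :=
    { toFun := fun x => x.1.1 0
      invFun := fun y => ⟨(![y, π y], 1), le_rfl, by rw [hπ]; simp⟩
      left_inv := fun x => Subtype.ext (Prod.ext (by
        ext j
        fin_cases j
        · rfl
        · exact (hx x).1.symm) (hx x).2.symm)
      right_inv := fun y => rfl }
  refine ⟨![e, e.trans π], fun j x => ?_⟩
  fin_cases j
  · rfl
  · exact (hx x).1.symm

theorem IsPerfectMatching.hasClass (hα : ∀ a ≤ 0, (indicatorDiagram k 0 a).HasClass α)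
    (hβ : ∀ a ∈ positiveQuadrant, (indicatorDiagram k 0 a).HasClass β)
    {W : (Fin 2 → ℤ) → ℤ} (hW : IsPerfectMatching W) :
    (matchingDiagram k W 0).HasClass
      ((∑ᶠ (a) (_ : a ∈ Set.Iic 0), W a) • α +
        (∑ᶠ (a) (_ : a ∈ positiveQuadrant), W a) • β) := by
  obtain ⟨e, he⟩ := hW.exists_equiv
  exact (hasClass_indicatorSum hα hβ hW.nonneg hW.1 hW.2.1).iso (matchingDiagramIso 0 e he).symm

theorem isWeightClass_iff (hα : ∀ a ≤ 0, (indicatorDiagram k 0 a).HasClass α)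
    (hβ : ∀ a ∈ positiveQuadrant, (indicatorDiagram k 0 a).HasClass β)
    {W : (Fin 2 → ℤ) → ℤ} (h₁ : IsInitiallyZero W) (h₂ : IsEventuallyZero W)
    (c : VirtualDiagram k) :
    IsWeightClass W 0 c ↔ c = (∑ᶠ (a) (_ : a ∈ Set.Iic 0), W a) • α +
        (∑ᶠ (a) (_ : a ∈ positiveQuadrant), W a) • β := by
  have hpos : IsInitiallyZero (fun a => max (W a) 0) ∧ IsEventuallyZero (fun a => max (W a) 0) :=
    ⟨h₁.imp fun m hm a ha => by simp [hm a ha], h₂.imp fun m hm a ha => by simp [hm a ha]⟩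
  have hneg : IsInitiallyZero (fun a => max (-W a) 0) ∧ IsEventuallyZero (fun a => max (-W a) 0) :=
    ⟨h₁.imp fun m hm a ha => by simp [hm a ha], h₂.imp fun m hm a ha => by simp [hm a ha]⟩
  have key : c.IsClassOf (indicatorSum k (fun a => max (W a) 0) 0)
      (indicatorSum k (fun a => max (-W a) 0) 0) ↔
      c = (∑ᶠ (a) (_ : a ∈ Set.Iic 0), W a) • α +
        (∑ᶠ (a) (_ : a ∈ positiveQuadrant), W a) • β := by
    -- W = W⁺ - W⁻ is written with one-term sums so that the additivity lemma for matchings also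
    -- covers this case.
    have hW : ∀ a, W a = ∑ _i : Unit, max (W a) 0 - ∑ _i : Unit, max (-W a) 0 := fun a => by
      simp only [Finset.univ_unique, Finset.sum_const, Finset.card_singleton, one_smul]
      omega
    rw [VirtualDiagram.isClassOf_iff
      (hasClass_indicatorSum hα hβ (fun a => le_max_right _ _) hpos.1 hpos.2)
      (hasClass_indicatorSum hα hβ (fun a => le_max_right _ _) hneg.1 hneg.2),
      finsum_mem_sum_sub_sum (fun _ => hpos.1.finite) (fun _ => hneg.1.finite) hW,
      finsum_mem_sum_sub_sum (fun _ => hpos.2.finite) (fun _ => hneg.2.finite) hW]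
    simp only [Finset.univ_unique, Finset.sum_const, Finset.card_singleton, one_smul, sub_smul]
    rw [add_sub_add_comm]
  refine ⟨fun h => key.1 h.2, fun h => ⟨fun s P Q hPQ => ?_, key.2 h⟩⟩
  obtain ⟨hP, hQ, hW⟩ := hPQ
  rw [VirtualDiagram.isClassOf_iff
    (KDiagram.HasClass.directSum fun i => (hP i).hasClass hα hβ)
    (KDiagram.HasClass.directSum fun i => (hQ i).hasClass hα hβ), h,
    finsum_mem_sum_sub_sum (fun i => (hP i).1.finite) (fun i => (hQ i).1.finite) hW,
    finsum_mem_sum_sub_sum (fun i => (hP i).2.1.finite) (fun i => (hQ i).2.1.finite) hW]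
  simp only [Finset.sum_add_distrib, ← Finset.sum_smul, sub_smul]
  rw [add_sub_add_comm]

end Classes

/-! ### Weights as mixed second differences. -/

section Weights

theorem sum_Ioc_eq_sum_Ioc_sub_one_add (u : ℤ → ℤ) {p q : ℤ} (h : p < q) :
    ∑ x ∈ Finset.Ioc p q, u x = ∑ x ∈ Finset.Ioc p (q - 1), u x + u q := by
  have : Finset.Ioc p q = insert q (Finset.Ioc p (q - 1)) := by
    ext x
    simp only [Finset.mem_insert, Finset.mem_Ioc]
    omega
  rw [this, Finset.sum_insert (by simp), add_comm]

theorem sum_Ioc_sub_sub_one (u : ℤ → ℤ) {p q : ℤ} (h : p ≤ q) :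
    ∑ x ∈ Finset.Ioc p q, (u x - u (x - 1)) = u q - u p := by
  induction q, h using Int.leInduction with
  | base => simp
  | succ q h ih =>
    rw [sum_Ioc_eq_sum_Ioc_sub_one_add _ (by omega), add_sub_cancel_right, ih]
    ring

/-- The mixed second difference of a function of two integers. -/
def mixedDiff (g : (Fin 2 → ℤ) → ℤ) (a : Fin 2 → ℤ) : ℤ :=
  g ![a 0, a 1] - g ![a 0 - 1, a 1] - (g ![a 0, a 1 - 1] - g ![a 0 - 1, a 1 - 1])

theorem sum_mixedDiff_row (g : (Fin 2 → ℤ) → ℤ) (x : ℤ) {q q' : ℤ} (h : q ≤ q') :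
    ∑ y ∈ Finset.Ioc q q', mixedDiff g ![x, y] =
      g ![x, q'] - g ![x - 1, q'] - (g ![x, q] - g ![x - 1, q]) :=
  sum_Ioc_sub_sub_one (fun y => g ![x, y] - g ![x - 1, y]) h

theorem sum_mixedDiff_column (g : (Fin 2 → ℤ) → ℤ) (y : ℤ) {p p' : ℤ} (h : p ≤ p') :
    ∑ x ∈ Finset.Ioc p p', mixedDiff g ![x, y] =
      g ![p', y] - g ![p', y - 1] - (g ![p, y] - g ![p, y - 1]) := by
  rw [← sum_Ioc_sub_sub_one (fun x => g ![x, y] - g ![x, y - 1]) h]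
  refine Finset.sum_congr rfl fun x _ => ?_
  simp only [mixedDiff, Matrix.cons_val_zero, Matrix.cons_val_one]
  ring

theorem sum_mixedDiff_box (g : (Fin 2 → ℤ) → ℤ) {p p' q q' : ℤ} (hp : p ≤ p') (hq : q ≤ q') :
    ∑ x ∈ Finset.Ioc p p', ∑ y ∈ Finset.Ioc q q', mixedDiff g ![x, y] =
      g ![p', q'] - g ![p', q] - (g ![p, q'] - g ![p, q]) := by
  rw [← sum_Ioc_sub_sub_one (fun x => g ![x, q'] - g ![x, q]) hp]
  refine Finset.sum_congr rfl fun x _ => ?_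
  rw [sum_mixedDiff_row g x hq]
  ring

theorem eq_vec_two (a : Fin 2 → ℤ) : a = ![a 0, a 1] := by
  ext i
  fin_cases i <;> rfl

theorem finsum_mem_eq_sum_box {W : (Fin 2 → ℤ) → ℤ} {A : Set (Fin 2 → ℤ)} {I J : Finset ℤ}
    (h₁ : ∀ a ∈ A, W a ≠ 0 → a 0 ∈ I ∧ a 1 ∈ J) (h₂ : ∀ x ∈ I, ∀ y ∈ J, ![x, y] ∈ A) :
    ∑ᶠ (a) (_ : a ∈ A), W a = ∑ x ∈ I, ∑ y ∈ J, W ![x, y] := by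
  classical
  rw [finsum_mem_eq_sum_of_subset (t := (I ×ˢ J).image fun z => ![z.1, z.2]) W, Finset.sum_image,
    Finset.sum_product]
  · intro x _ y _ h
    exact Prod.ext (congrFun h 0) (congrFun h 1)
  · rintro a ⟨ha, haW⟩
    rw [Finset.coe_image]
    exact ⟨(a 0, a 1), by simpa using h₁ a ha haW, (eq_vec_two a).symm⟩
  · intro a ha
    rw [Finset.coe_image] at ha
    obtain ⟨z, hz, rfl⟩ := ha
    rw [Finset.mem_coe, Finset.mem_product] at hz
    exact h₂ _ hz.1 _ hz.2

theorem finsum_le_eq_sum_box {W : (Fin 2 → ℤ) → ℤ} {m p q : ℤ} {d : Fin 2 → ℤ}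
    (hm : ∀ a, vecDeg a ≤ m → W a = 0) (hp : p + d 1 ≤ m) (hq : d 0 + q ≤ m) :
    ∑ᶠ (a : Fin 2 → ℤ) (_ : a ≤ d), W a =
      ∑ x ∈ Finset.Ioc p (d 0), ∑ y ∈ Finset.Ioc q (d 1), W ![x, y] := by
  refine finsum_mem_eq_sum_box (A := Set.Iic d) (fun a ha haW => ?_) fun x hx y hy => ?_
  · have ha' : a 0 ≤ d 0 ∧ a 1 ≤ d 1 := ⟨ha 0, ha 1⟩
    have : ¬ vecDeg a ≤ m := fun h => haW (hm a h)
    rw [vecDeg_two] at this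
    simp only [Finset.mem_Ioc]
    omega
  · rw [Set.mem_Iic, Pi.le_def, Fin.forall_fin_two]
    exact ⟨(Finset.mem_Ioc.1 hx).2, (Finset.mem_Ioc.1 hy).2⟩

theorem vecDeg_vec_two (x y : ℤ) : vecDeg ![x, y] = x + y := vecDeg_two _

theorem mixedDiff_eq_zero_of_vecDeg_le {g : (Fin 2 → ℤ) → ℤ} {m : ℤ}
    (hm : ∀ a, vecDeg a ≤ m → g a = 0) {a : Fin 2 → ℤ} (ha : vecDeg a ≤ m) :
    mixedDiff g a = 0 := by
  rw [vecDeg_two] at ha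
  simp only [mixedDiff]
  rw [hm ![a 0, a 1], hm ![a 0 - 1, a 1], hm ![a 0, a 1 - 1], hm ![a 0 - 1, a 1 - 1], sub_self]
  all_goals
    rw [vecDeg_vec_two]
    omega

/-- The mixed difference kills deg + C; the shift by 2 keeps the lowest of the four corners in the
range where g has this form. -/
theorem mixedDiff_eq_zero_of_le_vecDeg {g : (Fin 2 → ℤ) → ℤ} {b C : ℤ}
    (hb : ∀ a, b ≤ vecDeg a → g a = vecDeg a + C) {a : Fin 2 → ℤ} (ha : b + 2 ≤ vecDeg a) :
    mixedDiff g a = 0 := by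
  rw [vecDeg_two] at ha
  simp only [mixedDiff]
  rw [hb, hb, hb, hb] <;> simp only [vecDeg_vec_two] <;> omega

/-- The mixed second difference of an initially zero function is its weight. -/
theorem IsInitiallyZero.isWeight {g : (Fin 2 → ℤ) → ℤ} (hg : IsInitiallyZero g) :
    IsWeight g (mixedDiff g) := by
  obtain ⟨m, hm⟩ := hg
  refine ⟨⟨m, fun a => mixedDiff_eq_zero_of_vecDeg_le hm⟩, fun d => ?_⟩
  -- The box reaches down to degree at most m, so its three lower corner values vanish; the minimum
  -- with the coordinates of d keeps its sides correctly oriented.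
  rw [finsum_le_eq_sum_box (p := min (d 0) (m - d 1)) (q := min (d 1) (m - d 0))
    (fun a => mixedDiff_eq_zero_of_vecDeg_le hm) (by omega) (by omega),
    sum_mixedDiff_box g (by omega) (by omega), ← eq_vec_two, hm ![d 0, _], hm ![_, d 1],
    hm ![_, _]]
  · ring
  all_goals
    rw [vecDeg_vec_two]
    omega

theorem IsWeight.eq_mixedDiff {g W : (Fin 2 → ℤ) → ℤ} (h : IsWeight g W) : W = mixedDiff g := by
  obtain ⟨⟨m, hm⟩, hW⟩ := h
  funext a
  -- The lower corner is chosen once for all four values of g in the mixed difference, with room for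
  -- the decrements by 1, so that the four boxes differ only in their last row and column.
  have key : ∀ x y, x ≤ a 0 → y ≤ a 1 → g ![x, y] =
      ∑ z ∈ Finset.Ioc (min (a 0 - 1) (m - a 1)) x,
        ∑ w ∈ Finset.Ioc (min (a 1 - 1) (m - a 0)) y, W ![z, w] := by
    intro x y hx hy
    rw [hW]
    refine finsum_le_eq_sum_box hm ?_ ?_
    · change _ + y ≤ m
      omega
    · change x + _ ≤ m
      omega
  simp only [mixedDiff]
  rw [key _ _ le_rfl le_rfl, key _ _ (by omega) le_rfl, key _ _ le_rfl (by omega),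
    key _ _ (by omega) (by omega), sum_Ioc_eq_sum_Ioc_sub_one_add _ (q := a 0) (by omega),
    sum_Ioc_eq_sum_Ioc_sub_one_add _ (q := a 0) (by omega),
    sum_Ioc_eq_sum_Ioc_sub_one_add (fun w => W ![a 0, w]) (q := a 1) (by omega), ← eq_vec_two]
  ring

theorem IsRiemannFunction.isEventuallyZero_mixedDiff {g : (Fin 2 → ℤ) → ℤ} {C : ℤ}
    (hg : IsRiemannFunction g C) : IsEventuallyZero (mixedDiff g) := by
  obtain ⟨-, b, hb⟩ := hg
  exact ⟨b + 2, fun a => mixedDiff_eq_zero_of_le_vecDeg hb⟩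

theorem IsRiemannFunction.finsum_positiveQuadrant {g : (Fin 2 → ℤ) → ℤ} {C : ℤ}
    (hg : IsRiemannFunction g C) :
    ∑ᶠ (a) (_ : a ∈ positiveQuadrant), mixedDiff g a = g 0 - C := by
  obtain ⟨-, b, hb⟩ := hg
  -- W vanishes in the quadrant outside the box of side N, and three corners have degree at least b:
  -- (2N + C) - 2(N + C) + g(0) = g(0) - C.
  set N := max 0 (b + 2) with hN
  rw [finsum_mem_eq_sum_box (I := Finset.Ioc 0 N) (J := Finset.Ioc 0 N),
    sum_mixedDiff_box g (by omega) (by omega), hb ![N, N], hb ![N, 0], hb ![0, N],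
    eq_vec_two (0 : Fin 2 → ℤ)]
  · simp only [vecDeg_vec_two, Pi.zero_apply]
    ring
  iterate 3
    rw [vecDeg_vec_two]
    omega
  · intro a ha haW
    have ha' : 0 < a 0 ∧ 0 < a 1 := ha
    have : ¬ b + 2 ≤ vecDeg a := fun h => haW (mixedDiff_eq_zero_of_le_vecDeg hb h)
    rw [vecDeg_two] at this
    simp only [Finset.mem_Ioc]
    omega
  · exact fun x hx y hy => ⟨(Finset.mem_Ioc.1 hx).1, (Finset.mem_Ioc.1 hy).1⟩

theorem IsMatchingDecomposition.abs_le {W : (Fin 2 → ℤ) → ℤ} {s : ℕ}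
    {P : Fin (s + 1) → (Fin 2 → ℤ) → ℤ} {Q : Fin s → (Fin 2 → ℤ) → ℤ}
    (h : IsMatchingDecomposition W P Q) (a : Fin 2 → ℤ) : |W a| ≤ 2 * s + 1 := by
  have hle : ∀ V, IsPerfectMatching V → |V a| ≤ 1 := by
    rintro V ⟨-, -, π, hπ⟩
    rw [hπ]
    split_ifs <;> simp
  obtain ⟨hP, hQ, hW⟩ := h
  have h₁ : |∑ i, P i a| ≤ ∑ _i : Fin (s + 1), (1 : ℤ) :=
    (Finset.abs_sum_le_sum_abs _ _).trans (Finset.sum_le_sum fun i _ => hle _ (hP i))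
  have h₂ : |∑ i, Q i a| ≤ ∑ _i : Fin s, (1 : ℤ) :=
    (Finset.abs_sum_le_sum_abs _ _).trans (Finset.sum_le_sum fun i _ => hle _ (hQ i))
  simp only [Finset.sum_const, Finset.card_univ, Fintype.card_fin, nsmul_eq_mul, mul_one] at h₁ h₂
  rw [hW]
  refine (abs_sub _ _).trans ?_
  push_cast at h₁
  omega

theorem IsRiemannFunction.exists_isMatchingDecomposition_iff {g : (Fin 2 → ℤ) → ℤ} {C : ℤ}
    (hg : IsRiemannFunction g C) :
    (∃ (s : ℕ) (P : Fin (s + 1) → (Fin 2 → ℤ) → ℤ) (Q : Fin s → (Fin 2 → ℤ) → ℤ),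
      IsMatchingDecomposition (mixedDiff g) P Q) ↔ ∃ B : ℤ, ∀ a, |mixedDiff g a| ≤ B := by
  refine ⟨fun ⟨s, P, Q, h⟩ => ⟨_, h.abs_le⟩, fun ⟨B, hB⟩ => ?_⟩
  obtain ⟨⟨m, hm⟩, b, hb⟩ := hg
  -- A row sum telescopes to a unit step of g at degree M - 1 minus one at degree m. Since M - 2 ≥ b
  -- the first is 1, and the second is 0; M > m orients the interval.
  set M := max (b + 2) (m + 1) with hM
  have hIoo : ∀ x, Finset.Ioo (m - x) (M - x) = Finset.Ioc (m - x) (M - 1 - x) := fun x => by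
    ext y
    simp only [Finset.mem_Ioo, Finset.mem_Ioc]
    omega
  refine exists_isMatchingDecomposition (m := m) (M := M) (fun a ha => ?_) hB (fun x => ?_)
    fun y => ?_
  · have h₁ : ¬ vecDeg a ≤ m := fun h => ha (mixedDiff_eq_zero_of_vecDeg_le hm h)
    have h₂ : ¬ b + 2 ≤ vecDeg a := fun h => ha (mixedDiff_eq_zero_of_le_vecDeg hb h)
    rw [vecDeg_two] at h₁ h₂
    omega
  · rw [hIoo, sum_mixedDiff_row g x (by omega), hb ![x, _], hb ![x - 1, _], hm, hm]
    · simp only [vecDeg_vec_two]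
      ring
    all_goals
      rw [vecDeg_vec_two]
      omega
  · rw [hIoo, sum_mixedDiff_column g y (by omega), hb ![_, y], hb ![_, y - 1], hm, hm]
    · simp only [vecDeg_vec_two]
      ring
    all_goals
      rw [vecDeg_vec_two]
      omega

end Weights

/-! ### Restriction, duality and the class at a point. -/

section RiemannFunctions

variable {n : ℕ} {f : (Fin n → ℤ) → ℤ} {C : ℤ}

theorem vecDeg_sub (d e : Fin n → ℤ) : vecDeg (d - e) = vecDeg d - vecDeg e :=
  Finset.sum_sub_distrib _ _

theorem vecDeg_add_single_add_single (i j : Fin n) (d : Fin n → ℤ) (a : Fin 2 → ℤ) :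
    vecDeg (d + Pi.single i (a 0) + Pi.single j (a 1)) = vecDeg a + vecDeg d := by
  rw [vecDeg_two]
  simp only [vecDeg, Pi.add_apply, Finset.sum_add_distrib, Finset.sum_pi_single',
    Finset.mem_univ, if_true]
  ring

theorem IsRiemannFunction.twoVarRestriction (hf : IsRiemannFunction f C) (i j : Fin n)
    (d : Fin n → ℤ) : IsRiemannFunction (twoVarRestriction f i j d) (vecDeg d + C) := by
  obtain ⟨⟨m, hm⟩, b, hb⟩ := hf
  refine ⟨⟨m - vecDeg d, fun a ha => hm _ ?_⟩, b - vecDeg d, fun a ha => (hb _ ?_).trans ?_⟩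
  all_goals
    rw [vecDeg_add_single_add_single]
    omega

theorem IsRiemannFunction.riemannDual (hf : IsRiemannFunction f C) (K : Fin n → ℤ) :
    IsRiemannFunction (riemannDual f C K) (-vecDeg K - C) := by
  obtain ⟨⟨m, hm⟩, b, hb⟩ := hf
  refine ⟨⟨vecDeg K - b, fun a ha => ?_⟩, vecDeg K - m, fun a ha => ?_⟩
  · rw [_root_.riemannDual, hb, vecDeg_sub]
    · ring
    · rw [vecDeg_sub]
      omega
  · rw [_root_.riemannDual, hm, vecDeg_sub]
    · ring
    · rw [vecDeg_sub]
      omega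

theorem IsRiemannFunction.isVirtualDiagramAt {k : Type u} [Field k] {α β : VirtualDiagram k}
    (hα : ∀ a ≤ 0, (indicatorDiagram k 0 a).HasClass α)
    (hβ : ∀ a ∈ positiveQuadrant, (indicatorDiagram k 0 a).HasClass β)
    (hf : IsRiemannFunction f C) (d : Fin n → ℤ) :
    IsVirtualDiagramAt f d (f d • α + (f d - vecDeg d - C) • β) := by
  intro i j _ x
  have hg := hf.twoVarRestriction i j d
  have hw := hg.1.isWeight
  have h0 : _root_.twoVarRestriction f i j d 0 = f d := by simp [_root_.twoVarRestriction]
  -- The defining property of the weight, evaluated at the origin.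
  have h₁ : ∑ᶠ (a) (_ : a ∈ Set.Iic 0), mixedDiff (_root_.twoVarRestriction f i j d) a = f d :=
    (hw.2 0).symm.trans h0
  have key := isWeightClass_iff hα hβ hw.1 hg.isEventuallyZero_mixedDiff x
  rw [h₁, hg.finsum_positiveQuadrant, h0, ← sub_sub] at key
  constructor
  · rintro ⟨W, hW, hx⟩
    rw [hW.eq_mixedDiff] at hx
    exact key.1 hx
  · exact fun hx => ⟨_, hw, key.2 hx⟩

end RiemannFunctions

theorem mainTheorem6 (k : Type u) [Field k] (n : ℕ) (hn : 2 ≤ n) (f : (Fin n → ℤ) → ℤ) (C : ℤ)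
    (hf : IsRiemannFunction f C) :
    (∀ (d : Fin n → ℤ) (i j : Fin n), i ≠ j →
      ∃! W : (Fin 2 → ℤ) → ℤ, IsWeight (twoVarRestriction f i j d) W) ∧
    (∀ (d : Fin n → ℤ) (i j : Fin n), i ≠ j →
      ∀ W : (Fin 2 → ℤ) → ℤ, IsWeight (twoVarRestriction f i j d) W →
        ((∃ (s : ℕ) (P : Fin (s + 1) → (Fin 2 → ℤ) → ℤ) (Q : Fin s → (Fin 2 → ℤ) → ℤ),
            IsMatchingDecomposition W P Q) ↔ ∃ B : ℤ, ∀ a, |W a| ≤ B)) ∧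
    ∀ d K : Fin n → ℤ,
      IsRiemannFunction (riemannDual f C K) (-vecDeg K - C) ∧
      ∃ c c' : VirtualDiagram k,
        IsVirtualDiagramAt f d c ∧
        IsVirtualDiagramAt (riemannDual f C K) (K - d) c' ∧
        c.b0 = f d ∧
        c.eulerChar = vecDeg d + C ∧
        c.b1 = riemannDual f C K (K - d) ∧
        riemannDual f C K (K - d) = c'.b0 := by
  refine ⟨fun d i j _ => ?_, fun d i j _ W hW => ?_, fun d K => ⟨hf.riemannDual K, ?_⟩⟩
  · exact ⟨_, (hf.twoVarRestriction i j d).1.isWeight, fun W hW => hW.eq_mixedDiff⟩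
  · rw [hW.eq_mixedDiff]
    exact (hf.twoVarRestriction i j d).exists_isMatchingDecomposition_iff
  -- The same α and β serve f and its dual; b⁰ and b¹ read off their respective coefficients.
  · obtain ⟨α, β, hα, hβ, hα0, hα1, hβ0, hβ1⟩ := exists_indicatorDiagram_classes k
    have hdual : riemannDual f C K (K - d) = f d - vecDeg d - C := by
      rw [riemannDual, sub_sub_cancel]
    refine ⟨_, _, hf.isVirtualDiagramAt hα hβ d,
      (hf.riemannDual K).isVirtualDiagramAt hα hβ (K - d), ?_, ?_, ?_, ?_⟩
    · rw [VirtualDiagram.b0_zsmul_add_zsmul, hα0, hβ0]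
      ring
    · rw [VirtualDiagram.eulerChar, VirtualDiagram.b0_zsmul_add_zsmul,
        VirtualDiagram.b1_zsmul_add_zsmul, hα0, hβ0, hα1, hβ1]
      ring
    · rw [VirtualDiagram.b1_zsmul_add_zsmul, hα1, hβ1, hdual]
      ring
    · rw [VirtualDiagram.b0_zsmul_add_zsmul, hα0, hβ0]
      ring
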